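/- Let $d\ge 1$, $n\ge 1$, $R=2^n$, $\alpha\in\mathbb R$, $\varepsilon\ge 0$, $\gamma>1$. Let $\Lambda=\{0,\dots,R-1\}^d$ be a cube of the cubic lattice with $R$ sites along each edge, and consider one particle on $\Lambda$, with Hilbert space $\ell^2(\Lambda)$ and basis states $|j\rangle$, $j\in\Lambda$. For $0\le q\le n$ let $B_q=\{0,\dots,2^q-1\}^d$ be the subcube of $2^{qd}$ sites with corner at the initial site $\mathbf 0$, and let $B'_q=\{R-2^q,\dots,R-1\}\times\{0,\dots,2^q-1\}^{d-1}$ be the one with corner at the final site $\mathbf x=(R-1,0,\dots,0)$; put $\tilde B_q=B_q\setminus B_{q-1}$ and $\tilde B'_q=B'_q\setminus B'_{q-1}$. The W-state transfer protocol with couplings $h_{jk}$ runs through the expanding steps $q=1,\dots,n$ with $$H_q=\sum_{j\in B_{q-1}}\sum_{k\in\tilde B_q} i\,h_{jk}\,(|k\rangle\langle j|-|j\rangle\langle k|),$$ and then through the collapsing steps $q=n,\dots,1$ with $H'_q$, which is defined in the same way with $B'_{q-1},\tilde B'_q$ and $-h_{jk}$ in place of $B_{q-1},\tilde B_q$ and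 $h_{jk}$. The steps have durations $$t_q=\frac{\theta}{C_q\sqrt{|B_{q-1}|\,|\tilde B_q|}},\qquad t'_q=\frac{\theta}{C_q\sqrt{|B'_{q-1}|\,|\tilde B'_q|}},\qquad C_q=2^{-q\alpha},$$ where the rotation angle $\theta$ is any number with $0\le\theta\le\arctan(2^d-1)$; both $\theta=\arctan(2^d-1)$ and $\theta=\arctan\sqrt{2^d-1}$ are allowed. The full evolution is $$U=e^{-iH'_1t'_1}\cdots e^{-iH'_nt'_n}\,e^{-iH_nt_n}\cdots e^{-iH_1t_1}.$$ Let $U^{(0)}$ be the evolution of the ideal protocol, with $h_{jk}=C_q$ in step $q$ of either phase, and let $U$ be that of the perturbed protocol, with $h_{jk}=C_q(1+\varepsilon X_{jk})$, where in each single step the variables $X_{jk}$ of the coupled pairs are i.i.d. $\mathcal N(0,1)$. (No assumption is made on the joint law of different steps: one variable for each pair, kept throughout, and fresh variables in each step are both covered.) Let $\delta_{\rm rand}=\|U-U^{(0)}\|$ in operator norm. Put $$A=\tfrac12(\gamma-1)^2\left(1+2^{1-d}\sqrt{2^d-1}\right).$$ 1. (Error bound.) The bound $$\delta_{\rm rand}\le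 2\varepsilon\gamma\,\arctan(2^d-1)\left[1+(2^d-1)^{-1/2}\right]\frac{1-R^{-d/2}}{1-2^{-d/2}}$$ fails with probability $$P_{\rm fail}<2^{-A(d+1)+2}\,\frac{1-R^{-Ad}}{1-2^{-Ad}}.$$ 2. (Fidelity loss.) For every realization of the noise and every unit vector $\psi$, $1-|\langle U^{(0)}\psi,U\psi\rangle|^2\le\delta_{\rm rand}^2$. If $\theta=\arctan\sqrt{2^d-1}$, then $U^{(0)}|\mathbf 0\rangle=|\mathbf x\rangle$, and for every realization of the noise $1-|\langle\mathbf x|U|\mathbf 0\rangle|^2\le\delta_{\rm rand}^2$. 3. (No growth with distance.) For every real $R>0$, the right-hand sides of the two bounds in 1 are at most $$\frac{2\varepsilon\gamma\,\arctan(2^d-1)\left[1+(2^d-1)^{-1/2}\right]}{1-2^{-d/2}}\qquad\text{and}\qquad\frac{2^{-A(d+1)+2}}{1-2^{-Ad}},$$ respectively, and they converge to these finite values as $R\to\infty$. -/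

import Mathlib

open scoped InnerProductSpace

noncomputable section

namespace WState

/-- The sites of the `d`-dimensional cubic lattice in the largest cube, which has `2 ^ n` sites
along each edge: coordinates run over `0, …, 2 ^ n - 1`. -/
abbrev Site (d n : ℕ) : Type := Fin d → Fin (2 ^ n)

/-- The one-particle Hilbert space over the lattice. -/
abbrev Hilb (d n : ℕ) : Type := EuclideanSpace ℂ (Site d n)

/-- Operators on the one-particle Hilbert space, with the operator norm (largest singular
value). -/
abbrev Op (d n : ℕ) : Type := Hilb d n →L[ℂ] Hilb d n

/-- The basis state `|j⟩`. -/
def ket {d n : ℕ} (j : Site d n) : Hilb d n := EuclideanSpace.single j (1 : ℂ)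

/-- The operator `|j⟩⟨k|`. -/
def ketBra {d n : ℕ} (j k : Site d n) : Op d n := InnerProductSpace.rankOne ℂ (ket j) (ket k)

/-- The initial site `(0, …, 0)`. -/
def initialSite (d n : ℕ) : Site d n := fun _ => ⟨0, by positivity⟩

/-- The final site `(2 ^ n - 1, 0, …, 0)`, the other end of an edge of the largest cube. -/
def finalSite (d n : ℕ) : Site d n := fun i =>
  if (i : ℕ) = 0 then ⟨2 ^ n - 1, Nat.sub_lt (by positivity) one_pos⟩ else ⟨0, by positivity⟩

/-- The two phases of the protocol. -/
inductive Phase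
  | expanding
  | collapsing

/-- The cubes with `2 ^ q` sites along each edge: in the expanding phase the cube `B_q` whose
corner is the initial site, in the collapsing phase the cube `B'_q` whose corner is the final
site. -/
def cube (d n : ℕ) : Phase → ℕ → Finset (Site d n)
  | .expanding, q => {v | ∀ i, (v i : ℕ) < 2 ^ q}
  | .collapsing, q =>
      {v | ∀ i : Fin d, if (i : ℕ) = 0 then 2 ^ n ≤ (v i : ℕ) + 2 ^ q else (v i : ℕ) < 2 ^ q}

/-- The shell `B_q \ B_{q-1}` (for `q ≥ 1`). -/
def shell (d n : ℕ) (s : Phase) (q : ℕ) : Finset (Site d n) := cube d n s q \ cube d n s (q - 1)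

/-- The pairs `(j, k)` of sites that are coupled in step `q`: `j ∈ B_{q-1}` and
`k ∈ B_q \ B_{q-1}`. -/
def coupledPairs (d n : ℕ) (s : Phase) (q : ℕ) : Finset (Site d n × Site d n) :=
  cube d n s (q - 1) ×ˢ shell d n s q

/-- The ideal coupling strength `C_q = 2 ^ (-q α)`. -/
def idealCoupling (α : ℝ) (q : ℕ) : ℝ := (2 : ℝ) ^ (-((q : ℝ) * α))

/-- Expanding steps use the couplings `h`, collapsing steps the couplings `-h`. -/
def phaseSign : Phase → ℝ
  | .expanding => 1
  | .collapsing => -1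

/-- The step Hamiltonian
`∑_{j ∈ B_{q-1}} ∑_{k ∈ B_q \ B_{q-1}} i (± h_{jk}) (|k⟩⟨j| - |j⟩⟨k|)`. -/
def hamiltonian (d n : ℕ) (s : Phase) (q : ℕ) (h : Site d n → Site d n → ℝ) : Op d n :=
  ∑ j ∈ cube d n s (q - 1), ∑ k ∈ shell d n s q,
    (Complex.I * ((phaseSign s * h j k : ℝ) : ℂ)) • (ketBra k j - ketBra j k)

/-- The duration `t_q = θ / (C_q √(|B_{q-1}| |B_q \ B_{q-1}|))` of step `q`, in which the ideal
evolution rotates by the angle `θ`. -/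
def stepTime (d n : ℕ) (α θ : ℝ) (s : Phase) (q : ℕ) : ℝ :=
  θ / (idealCoupling α q *
    √(((cube d n s (q - 1)).card : ℝ) * ((shell d n s q).card : ℝ)))

/-- The evolution operator `exp(-i H_q t_q)` of one step. -/
def stepEvolution (d n : ℕ) (α θ : ℝ) (h : Phase → ℕ → Site d n → Site d n → ℝ)
    (s : Phase) (q : ℕ) : Op d n :=
  NormedSpace.exp
    ((-(Complex.I * (stepTime d n α θ s q : ℂ))) • hamiltonian d n s q (h s q))

/-- The expanding steps `1, …, m`, in this order of time: `U_m ⋯ U_1`. -/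
def expandingEvolution (d n : ℕ) (α θ : ℝ) (h : Phase → ℕ → Site d n → Site d n → ℝ) :
    ℕ → Op d n
  | 0 => 1
  | m + 1 => stepEvolution d n α θ h .expanding (m + 1) * expandingEvolution d n α θ h m

/-- The collapsing steps `m, …, 1`, in this order of time: `U'_1 ⋯ U'_m`. -/
def collapsingEvolution (d n : ℕ) (α θ : ℝ) (h : Phase → ℕ → Site d n → Site d n → ℝ) :
    ℕ → Op d n
  | 0 => 1
  | m + 1 => collapsingEvolution d n α θ h m * stepEvolution d n α θ h .collapsing (m + 1)

/-- The evolution operator `U'_1 ⋯ U'_n U_n ⋯ U_1` of the whole protocol. -/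
def evolution (d n : ℕ) (α θ : ℝ) (h : Phase → ℕ → Site d n → Site d n → ℝ) : Op d n :=
  collapsingEvolution d n α θ h n * expandingEvolution d n α θ h n

/-- The evolution of the ideal protocol, `h_{jk} = C_q`. -/
def idealEvolution (d n : ℕ) (α θ : ℝ) : Op d n :=
  evolution d n α θ fun _ q _ _ => idealCoupling α q

/-- The evolution with couplings `h_{jk} = C_q (1 + ε x_{jk})`. -/
def noisyEvolution (d n : ℕ) (α θ ε : ℝ) (x : Phase → ℕ → Site d n → Site d n → ℝ) : Op d n :=
  evolution d n α θ fun s q j k => idealCoupling α q * (1 + ε * x s q j k)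

/-- The total error `δ_rand`: the operator-norm deviation of the full evolution from the ideal
one. -/
def deltaRand (d n : ℕ) (α θ ε : ℝ) (x : Phase → ℕ → Site d n → Site d n → ℝ) : ℝ :=
  ‖noisyEvolution d n α θ ε x - idealEvolution d n α θ‖

/-- The prefactor `2 ε γ arctan(2^d - 1) [1 + (2^d - 1)^(-1/2)] / (1 - 2^(-d/2))`. -/
def errorLimit (d : ℕ) (ε γ : ℝ) : ℝ :=
  2 * ε * γ * Real.arctan ((2 : ℝ) ^ d - 1) * (1 + ((2 : ℝ) ^ d - 1) ^ (-(1 / 2) : ℝ)) /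
    (1 - (2 : ℝ) ^ (-((d : ℝ) / 2)))

/-- The error bound
`2 ε γ arctan(2^d - 1) [1 + (2^d - 1)^(-1/2)] (1 - R^(-d/2)) / (1 - 2^(-d/2))`. -/
def errorBound (d : ℕ) (ε γ R : ℝ) : ℝ :=
  2 * ε * γ * Real.arctan ((2 : ℝ) ^ d - 1) * (1 + ((2 : ℝ) ^ d - 1) ^ (-(1 / 2) : ℝ)) *
    ((1 - R ^ (-((d : ℝ) / 2))) / (1 - (2 : ℝ) ^ (-((d : ℝ) / 2))))

/-- The constant `A = ½ (γ - 1)² (1 + 2^(1-d) √(2^d - 1))`. -/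
def rateA (d : ℕ) (γ : ℝ) : ℝ :=
  1 / 2 * (γ - 1) ^ 2 * (1 + (2 : ℝ) ^ (1 - (d : ℝ)) * √((2 : ℝ) ^ d - 1))

/-- The value `2^(-A(d+1)+2) / (1 - 2^(-A d))`. -/
def failLimit (d : ℕ) (γ : ℝ) : ℝ :=
  (2 : ℝ) ^ (-(rateA d γ * ((d : ℝ) + 1)) + 2) / (1 - (2 : ℝ) ^ (-(rateA d γ * (d : ℝ))))

/-- The bound `2^(-A(d+1)+2) (1 - R^(-A d)) / (1 - 2^(-A d))` on the failure probability. -/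
def failBound (d : ℕ) (γ R : ℝ) : ℝ :=
  (2 : ℝ) ^ (-(rateA d γ * ((d : ℝ) + 1)) + 2) *
    ((1 - R ^ (-(rateA d γ * (d : ℝ)))) / (1 - (2 : ℝ) ^ (-(rateA d γ * (d : ℝ)))))

/-- Gaussian coupling noise: in every single step of the protocol, the noise variables `X_{jk}`
of the coupled pairs are independent and `N(0,1)`-distributed. Nothing is required of the joint
law of different steps, so both one variable for each pair of sites, kept throughout the
protocol, and fresh variables in each step are covered. -/
structure IsGaussianNoise {Ω : Type*} [MeasurableSpace Ω] (μ : MeasureTheory.Measure Ω)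
    (d n : ℕ) (X : Phase → ℕ → Site d n → Site d n → Ω → ℝ) : Prop where
  hasLaw : ∀ (s : Phase) (q : ℕ), 1 ≤ q → q ≤ n → ∀ p ∈ coupledPairs d n s q,
    ProbabilityTheory.HasLaw (X s q p.1 p.2) (ProbabilityTheory.gaussianReal 0 1) μ
  indep : ∀ (s : Phase) (q : ℕ), 1 ≤ q → q ≤ n →
    ProbabilityTheory.iIndepFun
      (fun p : {p : Site d n × Site d n // p ∈ coupledPairs d n s q} => X s q p.1.1 p.1.2) μ

end WState

end

/-!
The proof has a probabilistic and a deterministic half.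

All step evolutions are exponentials of skew-adjoint operators, hence unitary, so the errors of the
single steps add up (`norm_evolution_sub_le`). By Duhamel's formula the error of one step is at most
the norm of the difference of the generators (`norm_exp_sub_exp_le`). That difference is
`± θ ε / √(|B_{q-1}| |B_q \ B_{q-1}|)` times an off-diagonal block operator, whose norm is the norm
of the real noise matrix `X` (`norm_hop_le`). If every `X` satisfies
`‖X‖ ≤ γ (√|B_{q-1}| + √|B_q \ B_{q-1}|)`, the errors form a geometric series that sums to the
error bound (`deltaRand_le_errorBound`).

For an `N × M` matrix of independent standard Gaussian variables,
`‖X‖ > √N + √M + s` has probability at most `exp (-s² / 2)` (`stdGauss_not_bilin_le`). With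
`s = (γ - 1) (√N + √M)` the exponent is `A 2^{qd}`, and a union bound over the `2 n` steps gives
less than the claimed failure probability, with room to spare. The sharp constant `√N + √M` comes
from a Gaussian comparison: among centred Gaussian vectors with equal variances, larger covariances
decrease the expectation of `(∑ exp (y_i)) ^ r` for `r ≤ 1` (`integral_expSum_rpow_le`). This is
applied to the processes `⟨u, X v⟩ + g` and `⟨u, g'⟩ + ⟨v, g''⟩` on finitely many pairs of unit
vectors, whose covariances differ by `(1 - ⟨u, u'⟩) (1 - ⟨v, v'⟩) ≥ 0`. Taking
`y = (l / r)` times the process and letting `r → 0` turns `(∑ exp (y_i)) ^ r` into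
`exp (l max)`, and the comparison process is controlled by an exact exponential-moment bound for the
norm of a Gaussian vector (`integral_exp_mul_norm_stdGauss_le`). No number of pairs enters the
result, so it passes to a countable dense set of pairs.

Perfect transfer holds because the ideal steps are plane rotations between the W states of a cube
and of its shell (`exp_hop_const_wState`), and at `θ = arctan √(2^d - 1)` they carry the W state of
one cube to that of the next (`wState_cube_succ`). The loss of fidelity is bounded through
`1 - |⟨a, b⟩|² ≤ ‖a - b‖²` for unit vectors.
-/

namespace WState

/-! ### Gaussian integration by parts -/

section Gaussian

open MeasureTheory ProbabilityTheory

variable {κ : Type*} [Fintype κ]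

/-- The standard Gaussian measure on `ℝ^κ`, as a product measure. -/
noncomputable abbrev stdGauss (κ : Type*) [Fintype κ] : Measure (κ → ℝ) :=
  Measure.pi fun _ => gaussianReal 0 1

/-- Functions of at most exponential growth; they are integrable against Gaussian measures. -/
def ExpGrowth (g : (κ → ℝ) → ℝ) : Prop :=
  ∃ C c : ℝ, 0 ≤ C ∧ 0 ≤ c ∧ ∀ ξ, |g ξ| ≤ C * Real.exp (c * ∑ a, |ξ a|)

lemma ExpGrowth.mono {f g : (κ → ℝ) → ℝ} (hg : ExpGrowth g) (h : ∀ ξ, |f ξ| ≤ |g ξ|) :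
    ExpGrowth f := by
  obtain ⟨C, c, hC, hc, H⟩ := hg
  exact ⟨C, c, hC, hc, fun ξ => (h ξ).trans (H ξ)⟩

lemma ExpGrowth.add {f g : (κ → ℝ) → ℝ} (hf : ExpGrowth f) (hg : ExpGrowth g) :
    ExpGrowth fun ξ => f ξ + g ξ := by
  obtain ⟨C, c, hC, hc, H⟩ := hf
  obtain ⟨D, e, hD, he, H'⟩ := hg
  refine ⟨C + D, max c e, by positivity, by positivity, fun ξ => ?_⟩
  have h0 : 0 ≤ ∑ a, |ξ a| := by positivity
  calc |f ξ + g ξ| ≤ |f ξ| + |g ξ| := abs_add_le _ _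
    _ ≤ C * Real.exp (c * ∑ a, |ξ a|) + D * Real.exp (e * ∑ a, |ξ a|) := add_le_add (H ξ) (H' ξ)
    _ ≤ C * Real.exp (max c e * ∑ a, |ξ a|) + D * Real.exp (max c e * ∑ a, |ξ a|) := by
        gcongr <;> simp
    _ = _ := by ring

lemma ExpGrowth.mul {f g : (κ → ℝ) → ℝ} (hf : ExpGrowth f) (hg : ExpGrowth g) :
    ExpGrowth fun ξ => f ξ * g ξ := by
  obtain ⟨C, c, hC, hc, H⟩ := hf
  obtain ⟨D, e, hD, he, H'⟩ := hg
  refine ⟨C * D, c + e, by positivity, by positivity, fun ξ => ?_⟩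
  calc |f ξ * g ξ| = |f ξ| * |g ξ| := abs_mul _ _
    _ ≤ (C * Real.exp (c * ∑ a, |ξ a|)) * (D * Real.exp (e * ∑ a, |ξ a|)) :=
        mul_le_mul (H ξ) (H' ξ) (abs_nonneg _) (by positivity)
    _ = _ := by rw [add_mul, Real.exp_add]; ring

lemma ExpGrowth.const (C : ℝ) : ExpGrowth fun _ : κ → ℝ => C :=
  ⟨|C|, 0, abs_nonneg _, le_rfl, fun ξ => by simp⟩

lemma ExpGrowth.sum {ι : Type*} (s : Finset ι) {f : ι → (κ → ℝ) → ℝ}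
    (hf : ∀ i ∈ s, ExpGrowth (f i)) : ExpGrowth fun ξ => ∑ i ∈ s, f i ξ := by
  classical
  induction s using Finset.induction_on with
  | empty => simpa using ExpGrowth.const 0
  | insert i s hi ih =>
    simp only [Finset.sum_insert hi]
    exact (hf i (by simp)).add (ih fun j hj => hf j (by simp [hj]))

lemma expGrowth_exp_sum_abs (c : ℝ) (hc : 0 ≤ c) :
    ExpGrowth fun ξ : κ → ℝ => Real.exp (c * ∑ a, |ξ a|) :=
  ⟨1, c, zero_le_one, hc, fun ξ => by simp⟩

lemma expGrowth_sum_abs : ExpGrowth fun ξ : κ → ℝ => ∑ a, |ξ a| := by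
  refine (expGrowth_exp_sum_abs 1 zero_le_one).mono fun ξ => ?_
  have h0 : 0 ≤ ∑ a, |ξ a| := by positivity
  rw [abs_of_nonneg h0, Real.abs_exp, one_mul]
  linarith [Real.add_one_le_exp (∑ a, |ξ a|)]

lemma expGrowth_eval (a : κ) : ExpGrowth fun ξ : κ → ℝ => ξ a :=
  expGrowth_sum_abs.mono fun ξ =>
    (Finset.single_le_sum (f := fun a => |ξ a|) (fun _ _ => abs_nonneg _)
      (Finset.mem_univ a)).trans (le_abs_self _)

lemma ExpGrowth.integrable {g : (κ → ℝ) → ℝ} (hg : ExpGrowth g) (hc : Continuous g) :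
    Integrable g (stdGauss κ) := by
  obtain ⟨C, c, hC, hc', H⟩ := hg
  have h1 : Integrable (fun ξ : κ → ℝ => ∏ a, Real.exp (c * |ξ a|)) (stdGauss κ) := by
    refine Integrable.fintype_prod (f := fun _ x => Real.exp (c * |x|)) fun a => ?_
    have h := integrable_exp_mul_gaussianReal (μ := 0) (v := 1)
    exact integrable_exp_mul_abs (h c) (h (-c))
  refine (h1.const_mul C).mono' hc.aestronglyMeasurable (ae_of_all _ fun ξ => ?_)
  rw [← Real.exp_sum, ← Finset.mul_sum]
  exact H ξ

/-- The density of the standard Gaussian measure. -/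
noncomputable def stdDensity (ξ : κ → ℝ) : ℝ := ∏ a, gaussianPDFReal 0 1 (ξ a)

lemma stdDensity_nonneg (ξ : κ → ℝ) : 0 ≤ stdDensity ξ :=
  Finset.prod_nonneg fun _ _ => gaussianPDFReal_nonneg _ _ _

lemma measurable_stdDensity : Measurable (stdDensity : (κ → ℝ) → ℝ) :=
  Finset.measurable_prod _ fun a _ => (measurable_gaussianPDFReal 0 1).comp (measurable_pi_apply a)

lemma stdGauss_eq_withDensity :
    stdGauss κ = (volume : Measure (κ → ℝ)).withDensity
      fun ξ => ((stdDensity ξ).toNNReal : ENNReal) := by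
  refine Measure.pi_eq fun s hs => ?_
  have hint : ∀ a : κ, Integrable (gaussianPDFReal 0 1) (volume.restrict (s a)) :=
    fun a => (integrable_gaussianPDFReal 0 1).restrict
  have hint' : Integrable (fun ξ : κ → ℝ => stdDensity ξ)
      (Measure.pi fun a => volume.restrict (s a)) :=
    Integrable.fintype_prod (f := fun _ => gaussianPDFReal 0 1) hint
  have hval : ∫ ξ, stdDensity ξ ∂(Measure.pi fun a => volume.restrict (s a))
      = ∏ a, ∫ x in s a, gaussianPDFReal 0 1 x :=
    integral_fintype_prod_eq_prod (μ := fun a => volume.restrict (s a))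
      (f := fun _ : κ => gaussianPDFReal 0 1)
  have hreal : ∀ a, gaussianReal 0 1 (s a)
      = ENNReal.ofReal (∫ x in s a, gaussianPDFReal 0 1 x) := fun a =>
    gaussianReal_apply_eq_integral 0 one_ne_zero _
  rw [withDensity_apply _ (MeasurableSet.univ_pi hs), volume_pi, Measure.restrict_pi_pi]
  simp only [hreal]
  rw [← ENNReal.ofReal_prod_of_nonneg
    fun a _ => integral_nonneg fun x => gaussianPDFReal_nonneg _ _ _, ← hval,
    ofReal_integral_eq_lintegral_ofReal hint' (ae_of_all _ stdDensity_nonneg)]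
  rfl

lemma integral_stdGauss (g : (κ → ℝ) → ℝ) :
    ∫ ξ, g ξ ∂(stdGauss κ) = ∫ ξ, stdDensity ξ * g ξ := by
  rw [stdGauss_eq_withDensity, integral_withDensity_eq_integral_smul
    measurable_stdDensity.real_toNNReal]
  simp [NNReal.smul_def, stdDensity_nonneg]

lemma integrable_stdGauss_iff (g : (κ → ℝ) → ℝ) :
    Integrable g (stdGauss κ) ↔ Integrable fun ξ => stdDensity ξ * g ξ := by
  rw [stdGauss_eq_withDensity, integrable_withDensity_iff_integrable_coe_smul
    measurable_stdDensity.real_toNNReal]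
  simp [stdDensity_nonneg]

lemma hasDerivAt_gaussianPDFReal (x : ℝ) :
    HasDerivAt (gaussianPDFReal 0 1) (-x * gaussianPDFReal 0 1 x) x := by
  rw [gaussianPDFReal_def]
  have h : HasDerivAt (fun x : ℝ => -(x - 0) ^ 2 / (2 * ((1 : NNReal) : ℝ))) (-x) x := by
    have := (((hasDerivAt_id x).sub_const 0).pow 2).neg.div_const (2 * ((1 : NNReal) : ℝ))
    refine this.congr_deriv ?_
    simp
    ring
  refine (h.exp.const_mul _).congr_deriv ?_
  ring

lemma hasLineDerivAt_stdDensity [DecidableEq κ] (ξ : κ → ℝ) (a : κ) :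
    HasLineDerivAt ℝ (stdDensity : (κ → ℝ) → ℝ) (-ξ a * stdDensity ξ) ξ (Pi.single a 1) := by
  unfold HasLineDerivAt stdDensity
  have h : ∀ b ∈ Finset.univ, HasDerivAt
      (fun t : ℝ => gaussianPDFReal 0 1 ((ξ + t • (Pi.single a 1 : κ → ℝ)) b))
      (-ξ b * gaussianPDFReal 0 1 (ξ b) * (Pi.single a 1 : κ → ℝ) b) 0 := by
    intro b _
    have h1 : HasDerivAt (fun t : ℝ => (ξ + t • (Pi.single a 1 : κ → ℝ)) b)
        ((Pi.single a 1 : κ → ℝ) b) 0 := by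
      simpa using ((hasDerivAt_id (0 : ℝ)).mul_const ((Pi.single a 1 : κ → ℝ) b)).const_add (ξ b)
    have h2 := hasDerivAt_gaussianPDFReal ((ξ + (0 : ℝ) • (Pi.single a 1 : κ → ℝ)) b)
    have h3 := h2.comp (0 : ℝ) h1
    refine HasDerivAt.congr_deriv h3 ?_
    simp
  refine (HasDerivAt.fun_finsetProd h).congr_deriv ?_
  rw [Finset.sum_eq_single a]
  · simp only [zero_smul, add_zero, Pi.single_eq_same, mul_one, smul_eq_mul]
    rw [← Finset.mul_prod_erase _ _ (Finset.mem_univ a)]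
    ring
  · intro b _ hb
    simp [hb]
  · simp

/-- Gaussian integration by parts: `E[ξ_a g(ξ)] = E[∂_a g(ξ)]`. -/
lemma integral_eval_mul_stdGauss [DecidableEq κ] {g g' : (κ → ℝ) → ℝ} (a : κ)
    (hg : ExpGrowth g) (hg' : ExpGrowth g') (hgc : Continuous g) (hgc' : Continuous g')
    (hderiv : ∀ ξ, HasLineDerivAt ℝ g (g' ξ) ξ (Pi.single a 1)) :
    ∫ ξ, ξ a * g ξ ∂(stdGauss κ) = ∫ ξ, g' ξ ∂(stdGauss κ) := by
  have h1 : Integrable (fun ξ : κ → ℝ => ξ a * g ξ) (stdGauss κ) :=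
    ((expGrowth_eval a).mul hg).integrable (by fun_prop)
  have h2 := hg.integrable hgc
  have h3 := hg'.integrable hgc'
  rw [integrable_stdGauss_iff] at h1 h2 h3
  have key := integral_bilinear_hasLineDerivAt_right_eq_neg_left_of_integrable
    (μ := (volume : Measure (κ → ℝ))) (f := stdDensity) (f' := fun ξ => -ξ a * stdDensity ξ)
    (g := g) (g' := g') (v := Pi.single a 1) (B := ContinuousLinearMap.mul ℝ ℝ)
    (by refine h1.neg.congr (ae_of_all _ fun ξ => ?_)
        simp; ring) h3 h2
    (fun ξ _ => hasLineDerivAt_stdDensity ξ a) (fun ξ _ => hderiv ξ)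
  rw [integral_stdGauss, integral_stdGauss]
  simp only [ContinuousLinearMap.mul_apply'] at key
  rw [key, ← integral_neg]
  congr 1 with ξ
  ring

end Gaussian

/-! ### Gaussian comparison for partition functions -/

section Comparison

open MeasureTheory ProbabilityTheory

variable {ι κ : Type*} [Fintype κ]

/-- The family of linear forms with coefficient matrix `M`, evaluated at `ξ`. -/
def linForms (M : ι → κ → ℝ) (ξ : κ → ℝ) (i : ι) : ℝ := ∑ a, M i a * ξ a

@[fun_prop]
lemma continuous_linForms (M : ι → κ → ℝ) (i : ι) : Continuous fun ξ => linForms M ξ i := by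
  unfold linForms; fun_prop

lemma abs_linForms_le {M : ι → κ → ℝ} {c : ℝ} (hM : ∀ i a, |M i a| ≤ c) (ξ : κ → ℝ) (i : ι) :
    |linForms M ξ i| ≤ c * ∑ a, |ξ a| := by
  unfold linForms
  refine (Finset.abs_sum_le_sum_abs _ _).trans ?_
  rw [Finset.mul_sum]
  exact Finset.sum_le_sum fun a _ => by
    rw [abs_mul]; exact mul_le_mul_of_nonneg_right (hM i a) (abs_nonneg _)

lemma hasDerivAt_linForms_line [DecidableEq κ] (M : ι → κ → ℝ) (ξ : κ → ℝ) (a : κ) (i : ι) :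
    HasDerivAt (fun s : ℝ => linForms M (ξ + s • Pi.single a 1) i) (M i a) 0 := by
  have h : (fun s : ℝ => linForms M (ξ + s • Pi.single a 1) i)
      = fun s => linForms M ξ i + s * M i a := by
    funext s
    simp [linForms, mul_add, Finset.sum_add_distrib, Pi.single_apply, mul_comm]
  rw [h]
  simpa using ((hasDerivAt_id (0 : ℝ)).mul_const (M i a)).const_add (linForms M ξ i)

variable [Fintype ι]

/-- The partition function `∑ᵢ exp (yᵢ)`. -/
noncomputable def expSum (y : ι → ℝ) : ℝ := ∑ i, Real.exp (y i)

lemma exp_le_expSum (y : ι → ℝ) (i : ι) : Real.exp (y i) ≤ expSum y :=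
  Finset.single_le_sum (f := fun i => Real.exp (y i)) (fun _ _ => (Real.exp_pos _).le)
    (Finset.mem_univ i)

lemma expSum_pos [Nonempty ι] (y : ι → ℝ) : 0 < expSum y :=
  (Real.exp_pos _).trans_le (exp_le_expSum y (Classical.arbitrary ι))

@[fun_prop]
lemma continuous_expSum_linForms (M : ι → κ → ℝ) : Continuous fun ξ => expSum (linForms M ξ) := by
  unfold expSum; fun_prop

@[fun_prop]
lemma continuous_expSum_linForms_rpow [Nonempty ι] (M : ι → κ → ℝ) (p : ℝ) :
    Continuous fun ξ => expSum (linForms M ξ) ^ p :=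
  (continuous_expSum_linForms M).rpow_const fun _ => Or.inl (expSum_pos _).ne'

lemma expSum_rpow_le [Nonempty ι] {M : ι → κ → ℝ} {c r : ℝ} (hc : 0 ≤ c)
    (hM : ∀ i a, |M i a| ≤ c) (hr0 : 0 < r) (hr1 : r ≤ 1) (ξ : κ → ℝ) :
    expSum (linForms M ξ) ^ r ≤ (1 + Fintype.card ι) * Real.exp (c * ∑ a, |ξ a|) := by
  have hσ : 0 ≤ ∑ a, |ξ a| := by positivity
  have h0 := (expSum_pos (linForms M ξ)).le
  have h1 : expSum (linForms M ξ) ≤ Fintype.card ι * Real.exp (c * ∑ a, |ξ a|) := by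
    unfold expSum
    refine (Finset.sum_le_card_nsmul _ _ (Real.exp (c * ∑ a, |ξ a|)) fun i _ => ?_).trans ?_
    · exact Real.exp_le_exp.2 ((le_abs_self _).trans (abs_linForms_le hM ξ i))
    · simp
  have h2 : expSum (linForms M ξ) ^ r ≤ 1 + expSum (linForms M ξ) :=
    calc expSum (linForms M ξ) ^ r ≤ (1 + expSum (linForms M ξ)) ^ r :=
          Real.rpow_le_rpow h0 (by linarith) hr0.le
      _ ≤ (1 + expSum (linForms M ξ)) ^ (1 : ℝ) :=
          Real.rpow_le_rpow_of_exponent_le (by linarith) hr1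
      _ = _ := Real.rpow_one _
  have h3 : 1 ≤ Real.exp (c * ∑ a, |ξ a|) := Real.one_le_exp (by positivity)
  linarith

lemma expGrowth_expSum_rpow [Nonempty ι] (M : ι → κ → ℝ) {r : ℝ} (hr0 : 0 < r) (hr1 : r ≤ 1) :
    ExpGrowth fun ξ => expSum (linForms M ξ) ^ r := by
  have hM : ∀ i a, |M i a| ≤ ∑ i, ∑ a, |M i a| := fun i a =>
    (Finset.single_le_sum (f := fun a => |M i a|) (fun _ _ => abs_nonneg _)
      (Finset.mem_univ a)).trans
    (Finset.single_le_sum (f := fun i => ∑ a, |M i a|)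
      (fun _ _ => Finset.sum_nonneg fun _ _ => abs_nonneg _) (Finset.mem_univ i))
  refine ⟨1 + Fintype.card ι, ∑ i, ∑ a, |M i a|, by positivity, by positivity, fun ξ => ?_⟩
  rw [abs_of_nonneg (Real.rpow_nonneg (expSum_pos _).le _)]
  exact expSum_rpow_le (by positivity) hM hr0 hr1 ξ

/-- The partial derivative `∂ᵢ` of `y ↦ (∑ⱼ exp (yⱼ)) ^ r`. -/
noncomputable def powGrad (r : ℝ) (y : ι → ℝ) (i : ι) : ℝ :=
  r * expSum y ^ (r - 1) * Real.exp (y i)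

lemma powGrad_nonneg {r : ℝ} (hr0 : 0 < r) [Nonempty ι] (y : ι → ℝ) (i : ι) :
    0 ≤ powGrad r y i := by
  have := expSum_pos y
  unfold powGrad; positivity

lemma powGrad_le [Nonempty ι] {r : ℝ} (hr1 : r ≤ 1) (y : ι → ℝ) (i : ι) :
    powGrad r y i ≤ expSum y ^ r := by
  have h := expSum_pos y
  calc powGrad r y i ≤ 1 * expSum y ^ (r - 1) * expSum y := by
        unfold powGrad
        gcongr
        exact exp_le_expSum y i
    _ = expSum y ^ r := by rw [one_mul, ← Real.rpow_add_one h.ne']; simp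

lemma expGrowth_powGrad [Nonempty ι] (M : ι → κ → ℝ) {r : ℝ} (hr0 : 0 < r) (hr1 : r ≤ 1) (i : ι) :
    ExpGrowth fun ξ => powGrad r (linForms M ξ) i :=
  (expGrowth_expSum_rpow M hr0 hr1).mono fun ξ => by
    rw [abs_of_nonneg (powGrad_nonneg hr0 _ _)]
    exact (powGrad_le hr1 _ i).trans (le_abs_self _)

/-- Derivative of the partition function along a differentiable curve. -/
lemma hasDerivAt_expSum {y : ℝ → ι → ℝ} {y' : ι → ℝ} {t : ℝ}
    (hy : ∀ i, HasDerivAt (fun s => y s i) (y' i) t) :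
    HasDerivAt (fun s => expSum (y s)) (∑ i, Real.exp (y t i) * y' i) t := by
  unfold expSum
  exact HasDerivAt.fun_sum fun i _ => (hy i).exp

lemma hasDerivAt_expSum_rpow [Nonempty ι] {y : ℝ → ι → ℝ} {y' : ι → ℝ} {t : ℝ} (r : ℝ)
    (hy : ∀ i, HasDerivAt (fun s => y s i) (y' i) t) :
    HasDerivAt (fun s => expSum (y s) ^ r) (∑ i, powGrad r (y t) i * y' i) t := by
  refine ((hasDerivAt_expSum hy).rpow_const (p := r) (Or.inl (expSum_pos _).ne')).congr_deriv ?_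
  rw [Finset.sum_mul, Finset.sum_mul]
  refine Finset.sum_congr rfl fun i _ => ?_
  unfold powGrad; ring

/-- The Hessian form: derivative of `powGrad r · i` in the direction `v`. -/
noncomputable def powHess (r : ℝ) (y : ι → ℝ) (i : ι) (v : ι → ℝ) : ℝ :=
  powGrad r y i * v i + r * (r - 1) * expSum y ^ (r - 2) * Real.exp (y i) *
    ∑ j, Real.exp (y j) * v j

lemma hasDerivAt_powGrad [Nonempty ι] {y : ℝ → ι → ℝ} {y' : ι → ℝ} {t : ℝ} (r : ℝ) (i : ι)
    (hy : ∀ i, HasDerivAt (fun s => y s i) (y' i) t) :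
    HasDerivAt (fun s => powGrad r (y s) i) (powHess r (y t) i y') t := by
  have h1 := (hasDerivAt_expSum hy).rpow_const (p := r - 1) (Or.inl (expSum_pos _).ne')
  refine ((h1.const_mul r).mul (hy i).exp).congr_deriv ?_
  have : r - 1 - 1 = r - 2 := by ring
  unfold powHess powGrad
  rw [this]
  ring

lemma expGrowth_powHess [Nonempty ι] (M : ι → κ → ℝ) {r : ℝ} (hr0 : 0 < r) (hr1 : r ≤ 1)
    (i : ι) (v : ι → ℝ) : ExpGrowth fun ξ => powHess r (linForms M ξ) i v := by
  have h1 := (expGrowth_powGrad M hr0 hr1 i).mul (.const (v i))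
  have h2 : ExpGrowth fun ξ : κ → ℝ => ∑ j, v j * (r * (r - 1)) *
      (expSum (linForms M ξ) ^ (r - 2) * Real.exp (linForms M ξ i) *
        Real.exp (linForms M ξ j)) := by
    refine ExpGrowth.sum _ fun j _ => (ExpGrowth.const _).mul ?_
    refine (expGrowth_expSum_rpow M hr0 hr1).mono fun ξ => ?_
    have h := expSum_pos (linForms M ξ)
    rw [abs_of_nonneg (by positivity), abs_of_nonneg (by positivity)]
    calc _ ≤ expSum (linForms M ξ) ^ (r - 2) * expSum (linForms M ξ) * expSum (linForms M ξ) := by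
          gcongr <;> exact exp_le_expSum _ _
      _ = _ := by rw [← Real.rpow_add_one h.ne', ← Real.rpow_add_one h.ne']; ring_nf
  refine (h1.add h2).mono fun ξ => le_of_eq ?_
  unfold powHess
  rw [Finset.mul_sum]
  congr 2
  exact Finset.sum_congr rfl fun j _ => by ring

lemma continuous_powGrad [Nonempty ι] (M : ι → κ → ℝ) (r : ℝ) (i : ι) :
    Continuous fun ξ => powGrad r (linForms M ξ) i := by
  unfold powGrad; fun_prop

lemma continuous_powHess [Nonempty ι] (M : ι → κ → ℝ) (r : ℝ) (i : ι) (v : ι → ℝ) :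
    Continuous fun ξ => powHess r (linForms M ξ) i v := by
  unfold powHess powGrad; fun_prop

/-- Gaussian integration by parts for the gradient of the power of a partition function of
linear forms. -/
lemma integral_powGrad_mul_linForms [Nonempty ι] (M M' : ι → κ → ℝ) {r : ℝ}
    (hr0 : 0 < r) (hr1 : r ≤ 1) :
    ∫ ξ, ∑ i, powGrad r (linForms M ξ) i * linForms M' ξ i ∂(stdGauss κ) =
      ∫ ξ, ∑ i, ∑ a, M' i a * powHess r (linForms M ξ) i (fun j => M j a) ∂(stdGauss κ) := by
  classical
  have hI1 : ∀ i a, Integrable (fun ξ : κ → ℝ => ξ a * powGrad r (linForms M ξ) i)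
      (stdGauss κ) := fun i a =>
    ((expGrowth_eval a).mul (expGrowth_powGrad M hr0 hr1 i)).integrable
      ((continuous_apply a).mul (continuous_powGrad M r i))
  have hI2 : ∀ i a, Integrable (fun ξ : κ → ℝ => powHess r (linForms M ξ) i (fun j => M j a))
      (stdGauss κ) := fun i a =>
    (expGrowth_powHess M hr0 hr1 i _).integrable (continuous_powHess M r i _)
  have e1 : ∀ ξ : κ → ℝ, ∑ i, powGrad r (linForms M ξ) i * linForms M' ξ i
      = ∑ i, ∑ a, M' i a * (ξ a * powGrad r (linForms M ξ) i) := fun ξ =>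
    Finset.sum_congr rfl fun i _ => by
      rw [linForms, Finset.mul_sum]
      exact Finset.sum_congr rfl fun a _ => by ring
  simp only [e1]
  rw [integral_finsetSum _ fun i _ => integrable_finsetSum _ fun a _ => (hI1 i a).const_mul _,
    integral_finsetSum _ fun i _ => integrable_finsetSum _ fun a _ => (hI2 i a).const_mul _]
  refine Finset.sum_congr rfl fun i _ => ?_
  rw [integral_finsetSum _ fun a _ => (hI1 i a).const_mul _,
    integral_finsetSum _ fun a _ => (hI2 i a).const_mul _]
  refine Finset.sum_congr rfl fun a _ => ?_
  rw [integral_const_mul, integral_const_mul, integral_eval_mul_stdGauss a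
    (expGrowth_powGrad M hr0 hr1 i) (expGrowth_powHess M hr0 hr1 i (fun j => M j a))
    (continuous_powGrad M r i) (continuous_powHess M r i _)]
  intro ξ
  have := hasDerivAt_powGrad (y := fun s : ℝ => linForms M (ξ + s • Pi.single a 1)) r i
    (fun j => hasDerivAt_linForms_line M ξ a j)
  unfold HasLineDerivAt
  simpa using this

/-- If `M' Mᵀ` vanishes on the diagonal and is nonnegative elsewhere, the first variation of
the power is nonpositive: the mixed second derivatives are nonpositive because `r ≤ 1`. -/
lemma sum_powHess_nonpos [Nonempty ι] {M M' : ι → κ → ℝ} {r : ℝ} (hr0 : 0 < r) (hr1 : r ≤ 1)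
    (hdiag : ∀ i, ∑ a, M' i a * M i a = 0) (hoff : ∀ i j, 0 ≤ ∑ a, M' i a * M j a) (y : ι → ℝ) :
    ∑ i, ∑ a, M' i a * powHess r y i (fun j => M j a) ≤ 0 := by
  have hS := expSum_pos y
  refine Finset.sum_nonpos fun i _ => ?_
  have e : ∑ a, M' i a * powHess r y i (fun j => M j a)
      = powGrad r y i * (∑ a, M' i a * M i a) + r * (r - 1) * expSum y ^ (r - 2) * Real.exp (y i) *
        ∑ j, Real.exp (y j) * ∑ a, M' i a * M j a := by
    simp only [powHess, mul_add, Finset.sum_add_distrib, Finset.mul_sum]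
    congr 1
    · exact Finset.sum_congr rfl fun a _ => by ring
    · rw [Finset.sum_comm]
      exact Finset.sum_congr rfl fun j _ => Finset.sum_congr rfl fun a _ => by ring
  rw [e, hdiag i, mul_zero, zero_add]
  have h1 : 0 ≤ ∑ j, Real.exp (y j) * ∑ a, M' i a * M j a :=
    Finset.sum_nonneg fun j _ => mul_nonneg (Real.exp_pos _).le (hoff i j)
  refine mul_nonpos_of_nonpos_of_nonneg ?_ h1
  have h2 : 0 ≤ r * expSum y ^ (r - 2) * Real.exp (y i) := by positivity
  nlinarith

/-- **Gaussian comparison** for powers `r ≤ 1` of partition functions (Slepian, Kahane): if two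
centred Gaussian vectors have equal variances, then the one with the larger covariances has the
smaller expectation. The two vectors are given by linear forms in one standard Gaussian vector
that are mutually independent (`A Bᵀ = 0`), so that `cos t • B + sin t • A` interpolates. -/
theorem integral_expSum_rpow_le [Nonempty ι] {A B : ι → κ → ℝ} {r : ℝ} (hr0 : 0 < r) (hr1 : r ≤ 1)
    (hAB : ∀ i j, ∑ a, A i a * B j a = 0)
    (hdiag : ∀ i, ∑ a, A i a * A i a = ∑ a, B i a * B i a)
    (hoff : ∀ i j, ∑ a, B i a * B j a ≤ ∑ a, A i a * A j a) :
    ∫ ξ, expSum (linForms A ξ) ^ r ∂(stdGauss κ) ≤ ∫ ξ, expSum (linForms B ξ) ^ r ∂(stdGauss κ) := by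
  set M : ℝ → ι → κ → ℝ := fun t i a => Real.cos t * B i a + Real.sin t * A i a with hM
  set M' : ℝ → ι → κ → ℝ := fun t i a => -Real.sin t * B i a + Real.cos t * A i a with hM'
  set c : ℝ := ∑ i, ∑ a, (|A i a| + |B i a|) with hc
  have hc0 : 0 ≤ c := by positivity
  have hle : ∀ i a, |B i a| + |A i a| ≤ c := fun i a => by
    rw [add_comm]
    exact (Finset.single_le_sum (f := fun a => |A i a| + |B i a|) (fun _ _ => by positivity)
      (Finset.mem_univ a)).trans
      (Finset.single_le_sum (f := fun i => ∑ a, (|A i a| + |B i a|))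
        (fun _ _ => by positivity) (Finset.mem_univ i))
  have hMc : ∀ t i a, |M t i a| ≤ c := fun t i a => by
    refine (abs_add_le _ _).trans (le_trans ?_ (hle i a))
    rw [abs_mul, abs_mul]
    exact add_le_add (mul_le_of_le_one_left (abs_nonneg _) (Real.abs_cos_le_one t))
      (mul_le_of_le_one_left (abs_nonneg _) (Real.abs_sin_le_one t))
  have hMc' : ∀ t i a, |M' t i a| ≤ c := fun t i a => by
    refine (abs_add_le _ _).trans (le_trans ?_ (hle i a))
    rw [abs_mul, abs_mul, abs_neg]
    exact add_le_add (mul_le_of_le_one_left (abs_nonneg _) (Real.abs_sin_le_one t))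
      (mul_le_of_le_one_left (abs_nonneg _) (Real.abs_cos_le_one t))
  set f : ℝ → ℝ := fun t => ∫ ξ, expSum (linForms (M t) ξ) ^ r ∂(stdGauss κ) with hf
  have hderiv : ∀ t, HasDerivAt f (∫ ξ, ∑ i, powGrad r (linForms (M t) ξ) i * linForms (M' t) ξ i
      ∂(stdGauss κ)) t := by
    intro t
    have hbd : ExpGrowth fun ξ : κ → ℝ => Fintype.card ι * ((1 + Fintype.card ι) *
        Real.exp (c * ∑ a, |ξ a|) * (c * ∑ a, |ξ a|)) :=
      (ExpGrowth.const _).mul (((ExpGrowth.const _).mul (expGrowth_exp_sum_abs c hc0)).mul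
        ((ExpGrowth.const _).mul expGrowth_sum_abs))
    refine (hasDerivAt_integral_of_dominated_loc_of_deriv_le (s := Set.univ)
      (F' := fun t ξ => ∑ i, powGrad r (linForms (M t) ξ) i * linForms (M' t) ξ i) Filter.univ_mem
      (Filter.Eventually.of_forall fun s =>
        (continuous_expSum_linForms_rpow (M s) r).aestronglyMeasurable)
      ((expGrowth_expSum_rpow (M t) hr0 hr1).integrable (continuous_expSum_linForms_rpow (M t) r))
      ?_ ?_ (hbd.integrable (by fun_prop)) ?_).2
    · exact (continuous_finsetSum _ fun i _ => (continuous_powGrad (M t) r i).mul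
        (continuous_linForms (M' t) i)).aestronglyMeasurable
    · refine ae_of_all _ fun ξ s _ => ?_
      refine (norm_sum_le _ _).trans ?_
      refine (Finset.sum_le_card_nsmul _ _ ((1 + Fintype.card ι) *
        Real.exp (c * ∑ a, |ξ a|) * (c * ∑ a, |ξ a|)) fun i _ => ?_).trans (by simp)
      rw [norm_mul, Real.norm_eq_abs, Real.norm_eq_abs, abs_of_nonneg (powGrad_nonneg hr0 _ _)]
      exact mul_le_mul ((powGrad_le hr1 _ i).trans (expSum_rpow_le hc0 (hMc s) hr0 hr1 ξ))
        (abs_linForms_le (hMc' s) ξ i) (abs_nonneg _) (by positivity)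
    · refine ae_of_all _ fun ξ s _ => ?_
      refine hasDerivAt_expSum_rpow (y := fun s => linForms (M s) ξ) r fun i => ?_
      unfold linForms
      refine HasDerivAt.fun_sum fun a _ => ?_
      exact (((Real.hasDerivAt_cos s).mul_const _).add
        ((Real.hasDerivAt_sin s).mul_const _)).mul_const _
  have hprod : ∀ t i j, ∑ a, M' t i a * M t j a = Real.sin t * Real.cos t *
      (∑ a, A i a * A j a - ∑ a, B i a * B j a) := by
    intro t i j
    have h1 := hAB i j
    have h2 : ∑ a, B i a * A j a = 0 := by
      rw [← hAB j i]; exact Finset.sum_congr rfl fun a _ => mul_comm _ _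
    calc ∑ a, M' t i a * M t j a
        = Real.sin t * Real.cos t * (∑ a, A i a * A j a - ∑ a, B i a * B j a)
          + Real.cos t ^ 2 * ∑ a, A i a * B j a - Real.sin t ^ 2 * ∑ a, B i a * A j a := by
          simp only [Finset.mul_sum, ← Finset.sum_add_distrib, ← Finset.sum_sub_distrib]
          exact Finset.sum_congr rfl fun a _ => by simp only [hM, hM']; ring
      _ = _ := by rw [h1, h2]; ring
  have hanti : AntitoneOn f (Set.Icc 0 (Real.pi / 2)) := by
    refine antitoneOn_of_deriv_nonpos (convex_Icc _ _)
      (fun t _ => (hderiv t).continuousAt.continuousWithinAt)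
      (fun t _ => (hderiv t).differentiableAt.differentiableWithinAt) fun t ht => ?_
    rw [interior_Icc] at ht
    rw [(hderiv t).deriv, integral_powGrad_mul_linForms _ _ hr0 hr1]
    refine integral_nonpos fun ξ => sum_powHess_nonpos hr0 hr1 (fun i => ?_) (fun i j => ?_) _
    · rw [hprod, hdiag i, sub_self, mul_zero]
    · rw [hprod]
      have h1 := Real.sin_nonneg_of_nonneg_of_le_pi ht.1.le (by linarith [ht.2, Real.pi_pos])
      have h2 := Real.cos_nonneg_of_neg_pi_div_two_le_of_le (by linarith [ht.1, Real.pi_pos]) ht.2.le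
      exact mul_nonneg (mul_nonneg h1 h2) (sub_nonneg.2 (hoff i j))
  have := hanti (Set.left_mem_Icc.2 (by positivity)) (Set.right_mem_Icc.2 (by positivity))
    (by positivity : (0 : ℝ) ≤ Real.pi / 2)
  simpa [hf, hM] using this

end Comparison

section Tail

open MeasureTheory ProbabilityTheory

/-! ### The exponential moments of the norm of a Gaussian vector -/

lemma integral_exp_mul_sq_gaussianReal {b : ℝ} (hb : 0 < b) :
    ∫ x, Real.exp ((1 - b⁻¹ ^ 2) / 2 * x ^ 2) ∂(gaussianReal 0 1) = b := by
  rw [integral_gaussianReal_eq_integral_smul one_ne_zero]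
  have h : ∀ x : ℝ, gaussianPDFReal 0 1 x • Real.exp ((1 - b⁻¹ ^ 2) / 2 * x ^ 2)
      = (√(2 * Real.pi))⁻¹ * Real.exp (-(b⁻¹ ^ 2 / 2) * x ^ 2) := fun x => by
    simp only [gaussianPDFReal, smul_eq_mul, NNReal.coe_one, mul_one, sub_zero]
    rw [mul_assoc, ← Real.exp_add]
    ring_nf
  simp only [h]
  rw [integral_const_mul, integral_gaussian]
  have h2 : Real.pi / (b⁻¹ ^ 2 / 2) = b ^ 2 * (2 * Real.pi) := by field_simp
  rw [h2, Real.sqrt_mul (sq_nonneg b), Real.sqrt_sq hb.le]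
  have : √(2 * Real.pi) ≠ 0 := by positivity
  field_simp

lemma log_le_of_one_le {b : ℝ} (hb : 1 ≤ b) :
    Real.log b ≤ b - b⁻¹ + (b - b⁻¹) ^ 2 / 2 - (b ^ 2 - 1) / 2 := by
  have hb0 : 0 < b := by linarith
  have h1 : Real.log b ≤ (b - b⁻¹) / 2 := by
    rw [← Real.sinh_log hb0, Real.self_le_sinh_iff]
    exact Real.log_nonneg hb
  have hinv : b⁻¹ ≤ 1 := inv_le_one_of_one_le₀ hb
  have hinv0 : 0 < b⁻¹ := by positivity
  have hmul : b * b⁻¹ = 1 := mul_inv_cancel₀ hb0.ne'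
  have h2 : 0 ≤ (b - 1) - (1 - b⁻¹) := by nlinarith
  have h3 : 0 ≤ ((b - 1) - (1 - b⁻¹)) * (1 + b⁻¹) := by positivity
  nlinarith

variable {κ : Type*} [Fintype κ]

lemma sqrt_sum_sq_le_sum_abs (ξ : κ → ℝ) : √(∑ a, ξ a ^ 2) ≤ ∑ a, |ξ a| := by
  rw [Real.sqrt_le_left (by positivity)]
  have : ∑ a, ξ a ^ 2 = ∑ a, |ξ a| ^ 2 := by simp
  rw [this]
  exact Finset.sum_sq_le_sq_sum_of_nonneg fun _ _ => abs_nonneg _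

lemma integrable_exp_mul_norm_stdGauss {l : ℝ} (hl : 0 ≤ l) :
    Integrable (fun ξ : κ → ℝ => Real.exp (l * √(∑ a, ξ a ^ 2))) (stdGauss κ) := by
  refine ExpGrowth.integrable ((expGrowth_exp_sum_abs l hl).mono fun ξ => ?_) (by fun_prop)
  rw [Real.abs_exp, Real.abs_exp]
  exact Real.exp_le_exp.2 (mul_le_mul_of_nonneg_left (sqrt_sum_sq_le_sum_abs ξ) hl)

/-- The norm of a standard Gaussian vector in dimension `N` has exponential moments at most those
of a Gaussian variable with mean `√N` and variance one. -/
theorem integral_exp_mul_norm_stdGauss_le [Nonempty κ] {l : ℝ} (hl : 0 ≤ l) :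
    ∫ ξ, Real.exp (l * √(∑ a, ξ a ^ 2)) ∂(stdGauss κ)
      ≤ Real.exp (l * √(Fintype.card κ) + l ^ 2 / 2) := by
  set N : ℝ := (Fintype.card κ : ℝ) with hN
  have hN0 : 0 < N := by rw [hN]; exact_mod_cast Fintype.card_pos
  have hsN : 0 < √N := Real.sqrt_pos.2 hN0
  have hsq : √N ^ 2 = N := Real.sq_sqrt hN0.le
  -- `b` is the solution `≥ 1` of `b - 1 / b = l / √N`, the optimal choice in
  -- `2 ‖ξ‖ ≤ ‖ξ‖² / (b √N) + b √N`.
  set x : ℝ := l / √N with hx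
  have hx0 : 0 ≤ x := by positivity
  set b : ℝ := (x + √(x ^ 2 + 4)) / 2 with hb
  have hs4 : √(x ^ 2 + 4) ^ 2 = x ^ 2 + 4 := Real.sq_sqrt (by positivity)
  have hs4' : 2 ≤ √(x ^ 2 + 4) := Real.le_sqrt_of_sq_le (by nlinarith)
  have hb1 : 1 ≤ b := by rw [hb]; linarith
  have hb0 : 0 < b := by linarith
  have hbx : b * b = x * b + 1 := by rw [hb]; nlinarith
  have hbinv : b - b⁻¹ = x := by field_simp; nlinarith
  have hl' : l = √N * (b - b⁻¹) := by rw [hbinv, hx]; field_simp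
  have hpt : ∀ ξ : κ → ℝ, Real.exp (l * √(∑ a, ξ a ^ 2)) ≤
      Real.exp (N * (b ^ 2 - 1) / 2) * ∏ a, Real.exp ((1 - b⁻¹ ^ 2) / 2 * ξ a ^ 2) := by
    intro ξ
    rw [← Real.exp_sum, ← Real.exp_add, ← Finset.mul_sum]
    refine Real.exp_le_exp.2 ?_
    have hq : √(∑ a, ξ a ^ 2) ^ 2 = ∑ a, ξ a ^ 2 := Real.sq_sqrt (by positivity)
    set y := √(∑ a, ξ a ^ 2)
    rw [← hq]
    have hinv1 : b⁻¹ ≤ 1 := inv_le_one_of_one_le₀ hb1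
    have h1 : 0 ≤ (1 - b⁻¹ ^ 2) / 2 * (y - b * √N) ^ 2 := by
      have : b⁻¹ ^ 2 ≤ 1 := pow_le_one₀ (by positivity) hinv1
      have : 0 ≤ (1 - b⁻¹ ^ 2) / 2 := by linarith
      positivity
    have h2 : (1 - b⁻¹ ^ 2) * b = b - b⁻¹ := by field_simp
    have h3 : (1 - b⁻¹ ^ 2) * b ^ 2 = b ^ 2 - 1 := by field_simp
    have h4 : (1 - b⁻¹ ^ 2) / 2 * (y - b * √N) ^ 2 = (1 - b⁻¹ ^ 2) / 2 * y ^ 2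
        - ((1 - b⁻¹ ^ 2) * b) * √N * y + ((1 - b⁻¹ ^ 2) * b ^ 2) * √N ^ 2 / 2 := by ring
    rw [h4, h2, h3, hsq] at h1
    rw [hl']
    linarith
  have hint : ∀ a : κ, Integrable (fun x : ℝ => Real.exp ((1 - b⁻¹ ^ 2) / 2 * x ^ 2))
      (gaussianReal 0 1) := fun a => by
    by_contra h
    have := integral_exp_mul_sq_gaussianReal hb0
    rw [integral_undef h] at this
    exact hb0.ne this
  calc ∫ ξ, Real.exp (l * √(∑ a, ξ a ^ 2)) ∂(stdGauss κ)
      ≤ ∫ ξ, Real.exp (N * (b ^ 2 - 1) / 2) * ∏ a, Real.exp ((1 - b⁻¹ ^ 2) / 2 * ξ a ^ 2)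
          ∂(stdGauss κ) :=
        integral_mono (integrable_exp_mul_norm_stdGauss hl)
          ((Integrable.fintype_prod hint).const_mul _) hpt
    _ = Real.exp (N * (b ^ 2 - 1) / 2) * b ^ Fintype.card κ := by
        rw [integral_const_mul, integral_fintype_prod_eq_prod (μ := fun _ : κ => gaussianReal 0 1)
          (f := fun _ x => Real.exp ((1 - b⁻¹ ^ 2) / 2 * x ^ 2))]
        simp only [integral_exp_mul_sq_gaussianReal hb0, Finset.prod_const, Finset.card_univ]
    _ = Real.exp (N * (b ^ 2 - 1) / 2 + N * Real.log b) := by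
        rw [Real.exp_add, hN, ← Real.log_pow, Real.exp_log (by positivity)]
    _ ≤ _ := by
        refine Real.exp_le_exp.2 ?_
        have h := mul_le_mul_of_nonneg_left (log_le_of_one_le hb1) hN0.le
        have e : l * √N + l ^ 2 / 2 = N * (b - b⁻¹ + (b - b⁻¹) ^ 2 / 2) := by
          rw [hl', ← hsq]
          simp only [Real.sqrt_sq hsN.le]
          ring
        rw [e]
        linarith

end Tail

/-! ### The norm of a Gaussian matrix -/

section MatrixTail

open MeasureTheory ProbabilityTheory

lemma integral_stdGauss_sum_mul {κ₁ κ₂ : Type*} [Fintype κ₁] [Fintype κ₂]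
    (f : (κ₁ → ℝ) → ℝ) (g : (κ₂ → ℝ) → ℝ) :
    ∫ ξ, f (fun a => ξ (.inl a)) * g (fun a => ξ (.inr a)) ∂(stdGauss (κ₁ ⊕ κ₂))
      = (∫ ξ, f ξ ∂(stdGauss κ₁)) * ∫ ξ, g ξ ∂(stdGauss κ₂) := by
  rw [← integral_prod_mul]
  exact (measurePreserving_sumPiEquivProdPi (X := fun _ : κ₁ ⊕ κ₂ => ℝ)
    (fun _ => gaussianReal 0 1)).integral_comp' (g := fun z => f z.1 * g z.2)

lemma integral_exp_mul_stdGauss_unit (l : ℝ) :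
    ∫ ξ, Real.exp (l * ξ ()) ∂(stdGauss Unit) = Real.exp (l ^ 2 / 2) := by
  have h := integral_fintype_prod_eq_prod (μ := fun _ : Unit => gaussianReal 0 1)
    (f := fun _ x => Real.exp (l * x))
  have h2 := congrFun (mgf_id_gaussianReal (μ := 0) (v := 1)) l
  simp only [mgf, id] at h2
  simpa [h2] using h

variable {m n : Type*} [Fintype m] [Fintype n]

/-- The bilinear form `(u, v) ↦ ∑ u_j X_{jk} v_k` of the matrix `X`. -/
def bilin (X : m × n → ℝ) (u : m → ℝ) (v : n → ℝ) : ℝ := ∑ p : m × n, u p.1 * v p.2 * X p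

lemma sum_mul_le_one_of_unit (u u' : m → ℝ) (hu : ∑ j, u j ^ 2 = 1) (hu' : ∑ j, u' j ^ 2 = 1) :
    ∑ j, u j * u' j ≤ 1 := by
  have h := Finset.sum_mul_sq_le_sq_mul_sq Finset.univ u u'
  rw [hu, hu'] at h
  nlinarith

/-- Comparison of the Gaussian process `(u, v) ↦ ⟨u, X v⟩` on finitely many pairs of unit vectors
with `(u, v) ↦ ⟨g, u⟩ + ⟨h, v⟩`, at the level of smoothed maxima (Gordon, Chevet). An independent
Gaussian variable is added to the first process to make the variances equal, which yields the
factor `exp (l² / 2)`. -/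
lemma integral_expSum_bilin_rpow_le {ι : Type*} [Fintype ι] [Nonempty ι] [Nonempty m] [Nonempty n]
    (u : ι → m → ℝ) (v : ι → n → ℝ) (hu : ∀ i, ∑ j, u i j ^ 2 = 1) (hv : ∀ i, ∑ k, v i k ^ 2 = 1)
    {l r : ℝ} (hl : 0 ≤ l) (hr0 : 0 < r) (hr1 : r ≤ 1) :
    (∫ X, expSum (fun i => l / r * bilin X (u i) (v i)) ^ r ∂(stdGauss (m × n)))
        * Real.exp (l ^ 2 / 2) ≤
      (Fintype.card ι : ℝ) ^ r * (Real.exp (l * √(Fintype.card m) + l ^ 2 / 2) *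
        Real.exp (l * √(Fintype.card n) + l ^ 2 / 2)) := by
  set β := l / r with hβ
  have hβr : β * r = l := by rw [hβ]; field_simp
  have hβ0 : 0 ≤ β := by positivity
  -- Both processes are linear in one Gaussian vector `(X, g, g', g'')`: `A` gives
  -- `β (⟨u, X v⟩ + g)` and `B` gives `β (⟨u, g'⟩ + ⟨v, g''⟩)`.
  set A : ι → ((m × n) ⊕ Unit) ⊕ (m ⊕ n) → ℝ := fun i =>
    Sum.elim (Sum.elim (fun p => β * (u i p.1 * v i p.2)) fun _ => β) fun _ => 0 with hA
  set B : ι → ((m × n) ⊕ Unit) ⊕ (m ⊕ n) → ℝ := fun i =>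
    Sum.elim (fun _ => 0) (Sum.elim (fun j => β * u i j) fun k => β * v i k) with hB
  have hAA : ∀ i j, ∑ a, A i a * A j a
      = β ^ 2 * ((∑ a, u i a * u j a) * (∑ b, v i b * v j b) + 1) := by
    intro i j
    simp only [hA, Fintype.sum_sum_type, Sum.elim_inl, Sum.elim_inr, mul_zero,
      Finset.sum_const_zero, add_zero, Finset.univ_unique, Finset.sum_singleton]
    rw [Fintype.sum_prod_type, Finset.sum_mul_sum, mul_add, Finset.mul_sum, mul_one, sq]
    congr 1
    refine Finset.sum_congr rfl fun a _ => ?_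
    rw [Finset.mul_sum]
    exact Finset.sum_congr rfl fun b _ => by ring
  have hBB : ∀ i j, ∑ a, B i a * B j a
      = β ^ 2 * ((∑ a, u i a * u j a) + ∑ b, v i b * v j b) := by
    intro i j
    simp only [hB, Fintype.sum_sum_type, Sum.elim_inl, Sum.elim_inr, mul_zero,
      Finset.sum_const_zero, zero_add, mul_add, Finset.mul_sum]
    congr 1 <;> exact Finset.sum_congr rfl fun b _ => by ring
  have hu' : ∀ i, ∑ j, u i j * u i j = 1 := fun i => by simpa [sq] using hu i
  have hv' : ∀ i, ∑ j, v i j * v i j = 1 := fun i => by simpa [sq] using hv i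
  have hcomp := integral_expSum_rpow_le (A := A) (B := B) hr0 hr1
    (fun i j => by simp [hA, hB, Fintype.sum_sum_type])
    (fun i => by rw [hAA, hBB, hu', hv']; ring)
    (fun i j => by
      rw [hAA, hBB]
      have h1 := sum_mul_le_one_of_unit (u i) (u j) (hu i) (hu j)
      have h2 := sum_mul_le_one_of_unit (v i) (v j) (hv i) (hv j)
      refine mul_le_mul_of_nonneg_left ?_ (sq_nonneg β)
      nlinarith)
  have hleft : ∀ ξ : ((m × n) ⊕ Unit) ⊕ (m ⊕ n) → ℝ, expSum (linForms A ξ) ^ r =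
      ((expSum (fun i => β * bilin (fun p => ξ (.inl (.inl p))) (u i) (v i)) ^ r) *
        Real.exp (l * ξ (.inl (.inr ())))) * 1 := by
    intro ξ
    have e : expSum (linForms A ξ) = expSum (fun i => β * bilin (fun p => ξ (.inl (.inl p)))
        (u i) (v i)) * Real.exp (β * ξ (.inl (.inr ()))) := by
      unfold expSum
      rw [Finset.sum_mul]
      refine Finset.sum_congr rfl fun i _ => ?_
      rw [← Real.exp_add]
      congr 1
      simp [linForms, hA, Fintype.sum_sum_type, bilin, Finset.mul_sum, mul_assoc]
    rw [e, Real.mul_rpow (expSum_pos _).le (Real.exp_pos _).le, ← Real.exp_mul, mul_right_comm,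
      hβr, mul_one]
  have hright : ∀ ξ : ((m × n) ⊕ Unit) ⊕ (m ⊕ n) → ℝ, expSum (linForms B ξ) ^ r ≤
      (Fintype.card ι : ℝ) ^ r * (1 * (Real.exp (l * √(∑ j, ξ (.inr (.inl j)) ^ 2)) *
        Real.exp (l * √(∑ k, ξ (.inr (.inr k)) ^ 2)))) := by
    intro ξ
    set a := √(∑ j, ξ (.inr (.inl j)) ^ 2) with ha
    set b := √(∑ k, ξ (.inr (.inr k)) ^ 2) with hb
    have hlin : ∀ i, linForms B ξ i ≤ β * (a + b) := by
      intro i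
      have h1 := Real.sum_mul_le_sqrt_mul_sqrt Finset.univ (u i) fun j => ξ (.inr (.inl j))
      have h2 := Real.sum_mul_le_sqrt_mul_sqrt Finset.univ (v i) fun j => ξ (.inr (.inr j))
      rw [hu, Real.sqrt_one, one_mul] at h1
      rw [hv, Real.sqrt_one, one_mul] at h2
      have e : linForms B ξ i = β * (∑ j, u i j * ξ (.inr (.inl j)) +
          ∑ k, v i k * ξ (.inr (.inr k))) := by
        simp [linForms, hB, Fintype.sum_sum_type, Finset.mul_sum, mul_assoc, mul_add]
      rw [e]
      exact mul_le_mul_of_nonneg_left (add_le_add h1 h2) hβ0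
    have hS : expSum (linForms B ξ) ≤ Fintype.card ι * Real.exp (β * (a + b)) := by
      unfold expSum
      refine (Finset.sum_le_card_nsmul _ _ _ fun i _ => Real.exp_le_exp.2 (hlin i)).trans ?_
      simp
    refine (Real.rpow_le_rpow (expSum_pos _).le hS hr0.le).trans (le_of_eq ?_)
    rw [Real.mul_rpow (by positivity) (Real.exp_pos _).le, ← Real.exp_mul, one_mul,
      ← Real.exp_add, mul_right_comm, hβr, mul_add]
  have hintR : Integrable (fun ξ : ((m × n) ⊕ Unit) ⊕ (m ⊕ n) → ℝ => (Fintype.card ι : ℝ) ^ r *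
      (1 * (Real.exp (l * √(∑ j, ξ (.inr (.inl j)) ^ 2)) *
        Real.exp (l * √(∑ k, ξ (.inr (.inr k)) ^ 2))))) (stdGauss _) := by
    refine ExpGrowth.integrable ((ExpGrowth.const _).mul ((ExpGrowth.const _).mul
      (ExpGrowth.mul ?_ ?_))) (by fun_prop)
    · refine (expGrowth_exp_sum_abs l hl).mono fun ξ => ?_
      rw [Real.abs_exp, Real.abs_exp]
      refine Real.exp_le_exp.2 (mul_le_mul_of_nonneg_left ?_ hl)
      refine (Real.sqrt_le_sqrt ?_).trans (sqrt_sum_sq_le_sum_abs ξ)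
      rw [Fintype.sum_sum_type, Fintype.sum_sum_type (f := fun a : m ⊕ n => ξ (.inr a) ^ 2)]
      have h1 : 0 ≤ ∑ a : (m × n) ⊕ Unit, ξ (.inl a) ^ 2 := by positivity
      have h2 : 0 ≤ ∑ a : n, ξ (.inr (.inr a)) ^ 2 := by positivity
      linarith
    · refine (expGrowth_exp_sum_abs l hl).mono fun ξ => ?_
      rw [Real.abs_exp, Real.abs_exp]
      refine Real.exp_le_exp.2 (mul_le_mul_of_nonneg_left ?_ hl)
      refine (Real.sqrt_le_sqrt ?_).trans (sqrt_sum_sq_le_sum_abs ξ)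
      rw [Fintype.sum_sum_type, Fintype.sum_sum_type (f := fun a : m ⊕ n => ξ (.inr a) ^ 2)]
      have h1 : 0 ≤ ∑ a : (m × n) ⊕ Unit, ξ (.inl a) ^ 2 := by positivity
      have h2 : 0 ≤ ∑ a : m, ξ (.inr (.inl a)) ^ 2 := by positivity
      linarith
  have hR := integral_mono ((expGrowth_expSum_rpow B hr0 hr1).integrable
    (continuous_expSum_linForms_rpow B r)) hintR hright
  have hL : ∫ ξ, expSum (linForms A ξ) ^ r ∂(stdGauss (((m × n) ⊕ Unit) ⊕ (m ⊕ n))) =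
      (∫ X, expSum (fun i => β * bilin X (u i) (v i)) ^ r ∂(stdGauss (m × n)))
        * Real.exp (l ^ 2 / 2) := by
    simp only [hleft]
    rw [integral_stdGauss_sum_mul (fun ζ : (m × n) ⊕ Unit → ℝ =>
        (expSum (fun i => β * bilin (fun p => ζ (.inl p)) (u i) (v i)) ^ r) *
        Real.exp (l * ζ (.inr ()))) (fun _ : m ⊕ n → ℝ => 1),
      integral_stdGauss_sum_mul (fun X => expSum (fun i => β * bilin X (u i) (v i)) ^ r)
        (fun ζ : Unit → ℝ => Real.exp (l * ζ ())), integral_exp_mul_stdGauss_unit]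
    simp
  rw [← hL]
  refine hcomp.trans (hR.trans ?_)
  rw [integral_const_mul, integral_stdGauss_sum_mul (fun _ : (m × n) ⊕ Unit → ℝ => 1)
    (fun ζ : m ⊕ n → ℝ => Real.exp (l * √(∑ j, ζ (.inl j) ^ 2)) *
        Real.exp (l * √(∑ k, ζ (.inr k) ^ 2))),
    integral_stdGauss_sum_mul (fun ζ : m → ℝ => Real.exp (l * √(∑ j, ζ j ^ 2)))
      (fun ζ : n → ℝ => Real.exp (l * √(∑ k, ζ k ^ 2)))]
  refine mul_le_mul_of_nonneg_left ?_ (by positivity)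
  simp only [integral_const, probReal_univ, smul_eq_mul, one_mul, mul_one]
  exact mul_le_mul (integral_exp_mul_norm_stdGauss_le hl) (integral_exp_mul_norm_stdGauss_le hl)
    (integral_nonneg fun _ => (Real.exp_pos _).le) (Real.exp_pos _).le

/-- The tail bound for the largest value of the bilinear form of a Gaussian matrix on finitely
many pairs of unit vectors, uniform in their number. -/
lemma stdGauss_exists_bilin_le {ι : Type*} [Fintype ι] [Nonempty ι] [Nonempty m] [Nonempty n]
    (u : ι → m → ℝ) (v : ι → n → ℝ) (hu : ∀ i, ∑ j, u i j ^ 2 = 1) (hv : ∀ i, ∑ k, v i k ^ 2 = 1)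
    {s : ℝ} (hs : 0 ≤ s) :
    (stdGauss (m × n)).real
        {X | ∃ i, √(Fintype.card m) + √(Fintype.card n) + s < bilin X (u i) (v i)}
      ≤ Real.exp (-(s ^ 2 / 2)) := by
  set T := √(Fintype.card m) + √(Fintype.card n) + s with hT
  set P := (stdGauss (m × n)).real {X | ∃ i, T < bilin X (u i) (v i)} with hP
  -- Markov's inequality with exponent `r`; the number of pairs enters only through `card ι ^ r`,
  -- which tends to one as `r → 0`.
  have key : ∀ r : ℝ, 0 < r → r ≤ 1 → P ≤ (Fintype.card ι : ℝ) ^ r * Real.exp (-(s ^ 2 / 2)) := by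
    intro r hr0 hr1
    have hmain := integral_expSum_bilin_rpow_le u v hu hv hs hr0 hr1
    set f : (m × n → ℝ) → ℝ := fun X => expSum (fun i => s / r * bilin X (u i) (v i)) ^ r with hf
    have hfM : f = fun X => expSum (linForms (fun i p => s / r * (u i p.1 * v i p.2)) X) ^ r := by
      funext X
      simp only [hf]
      congr 2
      funext i
      simp [linForms, bilin, Finset.mul_sum, mul_assoc]
    have hint : Integrable f (stdGauss (m × n)) := by
      rw [hfM]
      exact (expGrowth_expSum_rpow _ hr0 hr1).integrable (continuous_expSum_linForms_rpow _ r)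
    have hmarkov := mul_meas_ge_le_integral_of_nonneg (μ := stdGauss (m × n)) (f := f)
      (ae_of_all _ fun X => Real.rpow_nonneg (expSum_pos _).le _) hint (Real.exp (s * T))
    have hsub : P ≤ (stdGauss (m × n)).real {X | Real.exp (s * T) ≤ f X} := by
      refine measureReal_mono ?_
      rintro X ⟨i, hi⟩
      have h1 : Real.exp (s / r * T) ≤ expSum (fun i => s / r * bilin X (u i) (v i)) :=
        (Real.exp_le_exp.2 (mul_le_mul_of_nonneg_left hi.le (by positivity))).trans
          (exp_le_expSum (fun i => s / r * bilin X (u i) (v i)) i)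
      have h2 := Real.rpow_le_rpow (Real.exp_pos _).le h1 hr0.le
      rw [← Real.exp_mul] at h2
      have h3 : s / r * T * r = s * T := by field_simp
      rwa [h3] at h2
    have hE := Real.exp_pos (s * T)
    have hE2 := Real.exp_pos (s ^ 2 / 2)
    have h4 : Real.exp (s * T) * P * Real.exp (s ^ 2 / 2) ≤ (Fintype.card ι : ℝ) ^ r *
        (Real.exp (s * √(Fintype.card m) + s ^ 2 / 2) *
          Real.exp (s * √(Fintype.card n) + s ^ 2 / 2)) :=
      (mul_le_mul_of_nonneg_right ((mul_le_mul_of_nonneg_left hsub hE.le).trans hmarkov)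
        hE2.le).trans hmain
    have h5 : Real.exp (s * √(Fintype.card m) + s ^ 2 / 2) *
          Real.exp (s * √(Fintype.card n) + s ^ 2 / 2)
        = Real.exp (-(s ^ 2 / 2)) * (Real.exp (s * T) * Real.exp (s ^ 2 / 2)) := by
      rw [← Real.exp_add, ← Real.exp_add, ← Real.exp_add, hT]
      congr 1
      ring
    rw [h5] at h4
    refine le_of_mul_le_mul_right ?_ (mul_pos hE hE2)
    linarith
  have hlim : Filter.Tendsto (fun r : ℝ => (Fintype.card ι : ℝ) ^ r * Real.exp (-(s ^ 2 / 2)))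
      (nhdsWithin 0 (Set.Ioi 0)) (nhds (1 * Real.exp (-(s ^ 2 / 2)))) := by
    refine Filter.Tendsto.mul_const _ ?_
    have hc : ContinuousAt (fun r : ℝ => (Fintype.card ι : ℝ) ^ r) 0 :=
      Real.continuousAt_const_rpow (by exact_mod_cast Fintype.card_ne_zero)
    have := hc.tendsto
    rw [Real.rpow_zero] at this
    exact this.mono_left nhdsWithin_le_nhds
  rw [one_mul] at hlim
  refine ge_of_tendsto hlim ?_
  filter_upwards [Ioc_mem_nhdsGT (zero_lt_one' ℝ)] with r hr
  exact key r hr.1 hr.2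

/-- **The norm of a Gaussian matrix** (Davidson–Szarek): the bilinear form of an `m × n` matrix of
independent standard Gaussian entries exceeds `√m + √n + s` at some pair of unit vectors with
probability at most `exp (- s² / 2)`. -/
theorem stdGauss_not_bilin_le (m n : Type*) [Fintype m] [Fintype n] {s : ℝ} (hs : 0 ≤ s) :
    stdGauss (m × n) {X | ¬ ∀ u v, ∑ j, u j ^ 2 = 1 → ∑ k, v k ^ 2 = 1 →
        bilin X u v ≤ √(Fintype.card m) + √(Fintype.card n) + s}
      ≤ ENNReal.ofReal (Real.exp (-(s ^ 2 / 2))) := by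
  set T := √(Fintype.card m) + √(Fintype.card n) + s with hT
  let W := {w : (m → ℝ) × (n → ℝ) // ∑ j, w.1 j ^ 2 = 1 ∧ ∑ k, w.2 k ^ 2 = 1}
  by_cases hW : Nonempty W
  swap
  · have : {X : m × n → ℝ | ¬ ∀ u v, ∑ j, u j ^ 2 = 1 → ∑ k, v k ^ 2 = 1 → bilin X u v ≤ T} = ∅ := by
      refine Set.eq_empty_of_forall_notMem fun X hX => hX fun u v hu hv => ?_
      exact absurd ⟨⟨(u, v), hu, hv⟩⟩ hW
    rw [this]; simp
  obtain ⟨w0⟩ := id hW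
  have : Nonempty m := by
    by_contra h
    have := w0.2.1
    rw [not_nonempty_iff] at h
    simp at this
  have : Nonempty n := by
    by_contra h
    have := w0.2.2
    rw [not_nonempty_iff] at h
    simp at this
  -- The event is open in the pair of vectors, so it is seen by a dense sequence of pairs.
  let w : ℕ → W := TopologicalSpace.denseSeq W
  let E : ℕ → Set (m × n → ℝ) := fun N => {X | ∃ i : Fin (N + 1), T < bilin X (w i).1.1 (w i).1.2}
  have hE : Monotone E := by
    rintro N N' hN X ⟨i, hi⟩
    exact ⟨⟨i, by omega⟩, hi⟩
  have hsub : {X : m × n → ℝ | ¬ ∀ u v, ∑ j, u j ^ 2 = 1 → ∑ k, v k ^ 2 = 1 → bilin X u v ≤ T}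
      ⊆ ⋃ N, E N := by
    intro X hX
    simp only [Set.mem_ofPred_eq, not_forall, not_le] at hX
    obtain ⟨u, v, hu, hv, h⟩ := hX
    have hopen : IsOpen {w : W | T < bilin X w.1.1 w.1.2} := by
      refine isOpen_lt continuous_const ?_
      unfold bilin
      fun_prop
    obtain ⟨N, hN⟩ := (TopologicalSpace.denseRange_denseSeq W).exists_mem_open hopen
      ⟨⟨(u, v), hu, hv⟩, h⟩
    exact Set.mem_iUnion.2 ⟨N, Fin.last N, by simpa using hN⟩
  refine (measure_mono hsub).trans ?_
  rw [hE.measure_iUnion]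
  refine iSup_le fun N => ?_
  rw [ENNReal.le_ofReal_iff_toReal_le (measure_ne_top _ _) (Real.exp_pos _).le]
  exact stdGauss_exists_bilin_le (fun i : Fin (N + 1) => (w i).1.1) (fun i => (w i).1.2)
    (fun i => (w i).2.1) (fun i => (w i).2.2) hs

end MatrixTail

/-! ### Exponentials of skew-adjoint operators -/

section Unitary

variable {E : Type*} [NormedAddCommGroup E] [InnerProductSpace ℂ E]

lemma norm_le_one_of_norm_map {U : E →L[ℂ] E} (hU : ∀ x, ‖U x‖ = ‖x‖) : ‖U‖ ≤ 1 :=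
  U.opNorm_le_bound zero_le_one fun x => by rw [hU, one_mul]

variable [CompleteSpace E]

lemma norm_exp_apply_of_mem_skewAdjoint {A : E →L[ℂ] E} (hA : A ∈ skewAdjoint (E →L[ℂ] E)) (x : E) :
    ‖NormedSpace.exp A x‖ = ‖x‖ := by
  let _ : NormedAlgebra ℚ (E →L[ℂ] E) := NormedAlgebra.restrictScalars ℚ ℂ (E →L[ℂ] E)
  have h : NormedSpace.exp A ∈ unitary (E →L[ℂ] E) :=
    NormedSpace.exp_mem_unitary_of_mem_skewAdjoint hA
  exact ContinuousLinearMap.norm_map_of_mem_unitary h x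

/-- Duhamel's estimate: the exponential is 1-Lipschitz on skew-adjoint operators, because
`t ↦ exp (t A) exp ((1 - t) B)` has derivative `exp (t A) (A - B) exp ((1 - t) B)`. -/
lemma norm_exp_sub_exp_le {A B : E →L[ℂ] E} (hA : A ∈ skewAdjoint (E →L[ℂ] E))
    (hB : B ∈ skewAdjoint (E →L[ℂ] E)) :
    ‖NormedSpace.exp A - NormedSpace.exp B‖ ≤ ‖A - B‖ := by
  have hbound : ∀ {C : E →L[ℂ] E}, C ∈ skewAdjoint (E →L[ℂ] E) → ∀ t : ℝ,
      ‖NormedSpace.exp (t • C)‖ ≤ 1 := fun hC t =>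
    norm_le_one_of_norm_map (norm_exp_apply_of_mem_skewAdjoint (skewAdjoint.smul_mem t hC))
  have hderiv : ∀ t : ℝ, HasDerivAt
      (fun t : ℝ => NormedSpace.exp (t • A) * NormedSpace.exp ((1 - t) • B))
      (NormedSpace.exp (t • A) * (A - B) * NormedSpace.exp ((1 - t) • B)) t := by
    intro t
    have h1 : HasDerivAt (fun t : ℝ => NormedSpace.exp (t • A)) (NormedSpace.exp (t • A) * A) t :=
      hasDerivAt_exp_smul_const (𝕂 := ℝ) A t
    have h2 := (hasDerivAt_exp_smul_const' (𝕂 := ℝ) B (1 - t)).scomp t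
      ((hasDerivAt_id t).const_sub 1)
    refine (h1.mul h2).congr_deriv ?_
    simp only [neg_smul, one_smul, Function.comp]
    noncomm_ring
  have := norm_image_sub_le_of_norm_deriv_le_segment_01' (C := ‖A - B‖)
    (fun t _ => (hderiv t).hasDerivWithinAt) fun t _ => by
      calc _ ≤ ‖NormedSpace.exp (t • A)‖ * ‖A - B‖ * ‖NormedSpace.exp ((1 - t) • B)‖ :=
            norm_mul₃_le
        _ ≤ 1 * ‖A - B‖ * 1 := by gcongr <;> apply hbound <;> assumption
        _ = _ := by ring
  simpa using this

lemma norm_mul_sub_mul_le {a a' b b' : E →L[ℂ] E} (ha : ‖a‖ ≤ 1) (hb' : ‖b'‖ ≤ 1) :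
    ‖a * b - a' * b'‖ ≤ ‖a - a'‖ + ‖b - b'‖ := by
  have e : a * b - a' * b' = a * (b - b') + (a - a') * b' := by noncomm_ring
  rw [e]
  refine (norm_add_le _ _).trans ?_
  have h1 : ‖a * (b - b')‖ ≤ 1 * ‖b - b'‖ := (norm_mul_le _ _).trans (by gcongr)
  have h2 : ‖(a - a') * b'‖ ≤ ‖a - a'‖ * 1 := (norm_mul_le _ _).trans (by gcongr)
  linarith

/-- The exponential of an infinitesimal rotation in the plane of `e₁` and `e₂`. -/
lemma exp_apply_of_rotation {G : E →L[ℂ] E} {θ : ℝ} {e₁ e₂ : E}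
    (h₁ : G e₁ = (θ : ℂ) • e₂) (h₂ : G e₂ = -(θ : ℂ) • e₁) :
    NormedSpace.exp G e₁ = (Real.cos θ : ℂ) • e₁ + (Real.sin θ : ℂ) • e₂ := by
  -- `e₁ ∓ i e₂` are eigenvectors with eigenvalues `± i θ`
  have heig : ∀ (c : ℂ) (w : E), G w = c • w → NormedSpace.exp G w = Complex.exp c • w := by
    intro c w hw
    have hpow : ∀ n : ℕ, (G ^ n) w = c ^ n • w := by
      intro n
      induction n with
      | zero => simp
      | succ n ih =>
        rw [pow_succ, mul_apply_eq_comp, hw, map_smul, ih, smul_smul, pow_succ']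
    have h1 := (NormedSpace.exp_series_hasSum_exp' (𝕂 := ℂ) G).mapL
      (ContinuousLinearMap.apply ℂ E w)
    have h2 := (NormedSpace.exp_series_hasSum_exp' (𝕂 := ℂ) c).smul_const w
    rw [← Complex.exp_eq_exp_ℂ] at h2
    refine h1.unique ?_
    convert h2 using 2 with n
    simp [hpow, smul_smul]
  have hp := heig (Complex.I * θ) (e₁ - Complex.I • e₂) (by
    rw [map_sub, map_smul, h₁, h₂]
    simp only [smul_sub, smul_smul]
    ring_nf
    simp [sub_eq_add_neg, add_comm, mul_comm])
  have hm := heig (-(Complex.I * θ)) (e₁ + Complex.I • e₂) (by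
    rw [map_add, map_smul, h₁, h₂]
    simp only [smul_add, smul_smul]
    ring_nf
    simp [add_comm, mul_comm])
  have e : e₁ = (1 / 2 : ℂ) • ((e₁ - Complex.I • e₂) + (e₁ + Complex.I • e₂)) := by
    module
  conv_lhs => rw [e]
  rw [map_smul, map_add, hp, hm, Complex.ofReal_cos, Complex.ofReal_sin, Complex.cos, Complex.sin,
    mul_comm Complex.I, neg_mul]
  module

end Unitary

/-! ### Hopping operators on the lattice -/

section Lattice

variable {d n : ℕ}

lemma ketBra_apply (j k : Site d n) (ψ : Hilb d n) : ketBra j k ψ = ψ k • ket j := by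
  simp [ketBra, ket, InnerProductSpace.rankOne_apply, EuclideanSpace.inner_single_left]

lemma star_ketBra (j k : Site d n) : star (ketBra j k) = ketBra k j := by
  rw [ContinuousLinearMap.star_eq_adjoint, ketBra, ketBra, InnerProductSpace.adjoint_rankOne]

lemma ket_apply (j l : Site d n) : ket j l = if l = j then 1 else 0 := by
  simp [ket]

/-- The real antisymmetric operator `∑ x_{jk} (|k⟩⟨j| - |j⟩⟨k|)` that couples the sites `j ∈ P` to
the sites `k ∈ Q`; it is `-i` times a Hamiltonian of the protocol. -/
noncomputable def hop (P Q : Finset (Site d n)) (x : Site d n → Site d n → ℝ) : Op d n :=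
  ∑ j ∈ P, ∑ k ∈ Q, ((x j k : ℝ) : ℂ) • (ketBra k j - ketBra j k)

lemma hop_mem_skewAdjoint (P Q : Finset (Site d n)) (x : Site d n → Site d n → ℝ) :
    hop P Q x ∈ skewAdjoint (Op d n) := by
  rw [skewAdjoint.mem_iff]
  simp only [hop, star_sum, star_sub, star_smul, star_ketBra, ← Finset.sum_neg_distrib,
    Complex.star_def, Complex.conj_ofReal]
  refine Finset.sum_congr rfl fun j _ => Finset.sum_congr rfl fun k _ => ?_
  rw [← neg_sub (ketBra k j)]
  exact smul_neg _ _

lemma hop_sub (P Q : Finset (Site d n)) (x y : Site d n → Site d n → ℝ) :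
    hop P Q x - hop P Q y = hop P Q fun j k => x j k - y j k := by
  simp only [hop, ← Finset.sum_sub_distrib, Complex.ofReal_sub]
  exact Finset.sum_congr rfl fun j _ => Finset.sum_congr rfl fun k _ => (sub_smul _ _ _).symm

lemma hop_const_mul (P Q : Finset (Site d n)) (c : ℝ) (x : Site d n → Site d n → ℝ) :
    hop P Q (fun j k => c * x j k) = (c : ℂ) • hop P Q x := by
  simp [hop, Finset.smul_sum, smul_smul]

lemma hop_apply (P Q : Finset (Site d n)) (x : Site d n → Site d n → ℝ) (ψ : Hilb d n)
    (l : Site d n) :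
    hop P Q x ψ l = (if l ∈ Q then ∑ j ∈ P, (x j l : ℂ) * ψ j else 0)
      - if l ∈ P then ∑ k ∈ Q, (x l k : ℂ) * ψ k else 0 := by
  have h1 : hop P Q x ψ l = ∑ j ∈ P, ∑ k ∈ Q, ((x j k : ℂ) * ψ j * (if l = k then 1 else 0)
      - (x j k : ℂ) * ψ k * if l = j then 1 else 0) := by
    simp only [hop, _root_.sum_apply, _root_.smul_apply,
      _root_.sub_apply, ketBra_apply, WithLp.ofLp_sum, Finset.sum_apply,
      PiLp.smul_apply, PiLp.sub_apply, ket_apply, smul_eq_mul, mul_sub, mul_assoc]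
  rw [h1]
  simp only [Finset.sum_sub_distrib]
  congr 1
  · split_ifs with h
    · simp [h]
    · simp [h]
  · rw [Finset.sum_comm]
    split_ifs with h
    · simp [h]
    · simp [h]

/-- The operator norm of `hop P Q x` is that of the real coefficient matrix `x`. -/
lemma norm_hop_le {P Q : Finset (Site d n)} (hPQ : Disjoint P Q) {x : Site d n → Site d n → ℝ}
    {T : ℝ} (hT : 0 ≤ T)
    (hx : ∀ u v : Site d n → ℝ, ∑ j ∈ P, ∑ k ∈ Q, u j * v k * x j k
      ≤ T * (√(∑ j ∈ P, u j ^ 2) * √(∑ k ∈ Q, v k ^ 2))) :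
    ‖hop P Q x‖ ≤ T := by
  -- Testing the bilinear bound on the image vector bounds the rows and the columns; the real and
  -- imaginary parts of a state are then treated separately.
  have aux : ∀ a b : ℝ, 0 ≤ a → 0 ≤ b → b ≤ T * (√a * √b) → b ≤ T ^ 2 * a := by
    intro a b ha hb h
    have ha' := Real.sq_sqrt ha
    have hb' := Real.sq_sqrt hb
    have h1 : √b ≤ T * √a := by
      rcases (Real.sqrt_nonneg b).eq_or_lt with h0 | h0
      · rw [← h0]; positivity
      · refine le_of_mul_le_mul_right ?_ h0
        nlinarith
    calc b = √b ^ 2 := hb'.symm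
      _ ≤ (T * √a) ^ 2 := by gcongr
      _ = T ^ 2 * a := by rw [mul_pow, ha']
  have hrow : ∀ u : Site d n → ℝ,
      ∑ k ∈ Q, (∑ j ∈ P, x j k * u j) ^ 2 ≤ T ^ 2 * ∑ j ∈ P, u j ^ 2 := by
    intro u
    refine aux _ _ (by positivity) (by positivity) (le_trans (le_of_eq ?_)
      (hx u fun k => ∑ j ∈ P, x j k * u j))
    rw [Finset.sum_comm]
    refine Finset.sum_congr rfl fun k _ => ?_
    rw [sq, Finset.sum_mul]
    exact Finset.sum_congr rfl fun j _ => by ring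
  have hcol : ∀ v : Site d n → ℝ,
      ∑ j ∈ P, (∑ k ∈ Q, x j k * v k) ^ 2 ≤ T ^ 2 * ∑ k ∈ Q, v k ^ 2 := by
    intro v
    refine aux _ _ (by positivity) (by positivity) (le_trans (le_of_eq ?_)
      ((hx (fun j => ∑ k ∈ Q, x j k * v k) v).trans (by rw [mul_comm √_])))
    refine Finset.sum_congr rfl fun j _ => ?_
    rw [sq, Finset.sum_mul]
    exact Finset.sum_congr rfl fun j _ => by ring
  have hnorm : ∀ z : ℂ, ‖z‖ ^ 2 = z.re ^ 2 + z.im ^ 2 := fun z => by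
    rw [Complex.sq_norm, Complex.normSq_apply]; ring
  refine (hop P Q x).opNorm_le_bound hT fun ψ => ?_
  refine le_of_sq_le_sq ?_ (by positivity)
  rw [EuclideanSpace.norm_sq_eq, mul_pow, EuclideanSpace.norm_sq_eq]
  have hl : ∀ l, ‖hop P Q x ψ l‖ ^ 2 = (if l ∈ Q then ‖∑ j ∈ P, (x j l : ℂ) * ψ j‖ ^ 2 else 0)
      + if l ∈ P then ‖∑ k ∈ Q, (x l k : ℂ) * ψ k‖ ^ 2 else 0 := by
    intro l
    rw [hop_apply]
    by_cases hQ : l ∈ Q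
    · have hP : l ∉ P := Finset.disjoint_right.1 hPQ hQ
      simp [hQ, hP]
    · by_cases hP : l ∈ P <;> simp [hQ, hP]
  simp only [hl, Finset.sum_add_distrib, Finset.sum_ite_mem, Finset.univ_inter, hnorm,
    Complex.re_sum, Complex.im_sum, Complex.re_ofReal_mul, Complex.im_ofReal_mul]
  have h1 := hrow fun j => (ψ j).re
  have h2 := hrow fun j => (ψ j).im
  have h3 := hcol fun j => (ψ j).re
  have h4 := hcol fun j => (ψ j).im
  have h5 : ∑ l ∈ P, ((ψ l).re ^ 2 + (ψ l).im ^ 2) + ∑ l ∈ Q, ((ψ l).re ^ 2 + (ψ l).im ^ 2)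
      ≤ ∑ l, ((ψ l).re ^ 2 + (ψ l).im ^ 2) := by
    rw [← Finset.sum_union hPQ]
    exact Finset.sum_le_sum_of_subset_of_nonneg (Finset.subset_univ _)
      fun _ _ _ => by positivity
  have h6 := mul_le_mul_of_nonneg_left h5 (sq_nonneg T)
  simp only [Finset.sum_add_distrib] at h6 ⊢
  linarith

/-! ### The cubes and their shells -/

lemma card_filter_val_lt_two_pow {q : ℕ} (hq : q ≤ n) :
    (Finset.univ.filter fun v : Fin (2 ^ n) => (v : ℕ) < 2 ^ q).card = 2 ^ q := by
  have h : 2 ^ q ≤ 2 ^ n := Nat.pow_le_pow_right (by norm_num) hq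
  rw [Fin.card_filter_val_lt]
  exact min_eq_right h

lemma card_filter_two_pow_le_val_add {q : ℕ} (hq : q ≤ n) :
    (Finset.univ.filter fun v : Fin (2 ^ n) => 2 ^ n ≤ (v : ℕ) + 2 ^ q).card = 2 ^ q := by
  refine (Finset.card_equiv Fin.revPerm fun v => ?_).trans (card_filter_val_lt_two_pow hq)
  have := v.isLt
  simp only [Finset.mem_filter, Finset.mem_univ, true_and, Fin.revPerm_apply, Fin.val_rev]
  omega

lemma card_cube (s : Phase) {q : ℕ} (hq : q ≤ n) : (cube d n s q).card = (2 ^ q) ^ d := by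
  cases s with
  | expanding =>
    have h : cube d n .expanding q
        = Fintype.piFinset fun _ => Finset.univ.filter fun v : Fin (2 ^ n) => (v : ℕ) < 2 ^ q := by
      ext v; simp [cube, Fintype.mem_piFinset]
    rw [h, Fintype.card_piFinset]
    simp [card_filter_val_lt_two_pow hq]
  | collapsing =>
    have h : cube d n .collapsing q = Fintype.piFinset fun i : Fin d =>
        if (i : ℕ) = 0 then Finset.univ.filter fun v : Fin (2 ^ n) => 2 ^ n ≤ (v : ℕ) + 2 ^ q
        else Finset.univ.filter fun v : Fin (2 ^ n) => (v : ℕ) < 2 ^ q := by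
      ext v
      simp only [cube, Finset.mem_filter, Finset.mem_univ, true_and, Fintype.mem_piFinset]
      refine forall_congr' fun i => ?_
      split_ifs <;> simp
    rw [h, Fintype.card_piFinset]
    have h2 : ∀ i : Fin d, (if (i : ℕ) = 0 then
        Finset.univ.filter fun v : Fin (2 ^ n) => 2 ^ n ≤ (v : ℕ) + 2 ^ q
        else Finset.univ.filter fun v : Fin (2 ^ n) => (v : ℕ) < 2 ^ q).card = 2 ^ q := by
      intro i
      split_ifs
      · exact card_filter_two_pow_le_val_add hq
      · exact card_filter_val_lt_two_pow hq
    simp [h2]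

lemma cube_subset_succ (s : Phase) (m : ℕ) : cube d n s m ⊆ cube d n s (m + 1) := by
  have h : 2 ^ m ≤ 2 ^ (m + 1) := Nat.pow_le_pow_right (by norm_num) (by omega)
  intro v hv
  cases s with
  | expanding =>
    simp only [cube, Finset.mem_filter, Finset.mem_univ, true_and] at hv ⊢
    exact fun i => (hv i).trans_le h
  | collapsing =>
    simp only [cube, Finset.mem_filter, Finset.mem_univ, true_and] at hv ⊢
    intro i
    have := hv i
    split_ifs at this ⊢ <;> omega

lemma disjoint_cube_shell (s : Phase) (m : ℕ) :
    Disjoint (cube d n s m) (shell d n s (m + 1)) :=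
  Finset.disjoint_sdiff

lemma cube_union_shell (s : Phase) (m : ℕ) :
    cube d n s m ∪ shell d n s (m + 1) = cube d n s (m + 1) :=
  Finset.union_sdiff_of_subset (cube_subset_succ s m)

lemma cast_card_cube (s : Phase) {m : ℕ} (hm : m ≤ n) :
    ((cube d n s m).card : ℝ) = ((2 : ℝ) ^ d) ^ m := by
  rw [card_cube s hm]; push_cast; rw [← pow_mul, ← pow_mul, mul_comm]

lemma cast_card_shell (s : Phase) {m : ℕ} (hm : m < n) :
    ((shell d n s (m + 1)).card : ℝ) = ((2 : ℝ) ^ d - 1) * ((2 : ℝ) ^ d) ^ m := by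
  have h := Finset.card_union_of_disjoint (disjoint_cube_shell (d := d) (n := n) s m)
  rw [cube_union_shell] at h
  have h' : ((cube d n s (m + 1)).card : ℝ) = (cube d n s m).card + (shell d n s (m + 1)).card := by
    exact_mod_cast h
  rw [cast_card_cube s (by omega), cast_card_cube s hm.le] at h'
  rw [pow_succ] at h'
  linarith

lemma cube_expanding_self : cube d n .expanding n = Finset.univ := by
  ext v
  simp only [cube, Finset.mem_filter, Finset.mem_univ, true_and, iff_true]
  exact fun i => (v i).isLt

lemma cube_collapsing_self : cube d n .collapsing n = Finset.univ := by
  ext v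
  simp only [cube, Finset.mem_filter, Finset.mem_univ, true_and, iff_true]
  intro i
  have := (v i).isLt
  split_ifs <;> omega

lemma cube_expanding_zero : cube d n .expanding 0 = {initialSite d n} := by
  ext v
  simp only [cube, initialSite, Finset.mem_filter, Finset.mem_univ, true_and,
    Finset.mem_singleton, funext_iff]
  refine forall_congr' fun i => ?_
  rw [Fin.ext_iff]
  simp only [pow_zero]
  omega

lemma cube_collapsing_zero : cube d n .collapsing 0 = {finalSite d n} := by
  ext v
  simp only [cube, finalSite, Finset.mem_filter, Finset.mem_univ, true_and, Finset.mem_singleton,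
    funext_iff]
  refine forall_congr' fun i => ?_
  have := (v i).isLt
  split_ifs
  · rw [Fin.ext_iff]; simp only [pow_zero]; omega
  · rw [Fin.ext_iff]; simp only [pow_zero]; omega

end Lattice

/-! ### The evolution of the protocol -/

section Protocol

variable {d n : ℕ}

lemma idealCoupling_pos (α : ℝ) (q : ℕ) : 0 < idealCoupling α q :=
  Real.rpow_pos_of_pos two_pos _

lemma stepEvolution_eq_exp_hop (α θ : ℝ) (h : Phase → ℕ → Site d n → Site d n → ℝ)
    (s : Phase) (q : ℕ) :
    stepEvolution d n α θ h s q = NormedSpace.exp (hop (cube d n s (q - 1)) (shell d n s q)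
      fun j k => stepTime d n α θ s q * (phaseSign s * h s q j k)) := by
  unfold stepEvolution hamiltonian
  congr 1
  simp only [hop, Finset.smul_sum, smul_smul]
  refine Finset.sum_congr rfl fun j _ => Finset.sum_congr rfl fun k _ => ?_
  congr 1
  push_cast
  linear_combination (-(stepTime d n α θ s q : ℂ) * (phaseSign s * h s q j k)) * Complex.I_sq

lemma norm_stepEvolution_apply (α θ : ℝ) (h : Phase → ℕ → Site d n → Site d n → ℝ)
    (s : Phase) (q : ℕ) (ψ : Hilb d n) : ‖stepEvolution d n α θ h s q ψ‖ = ‖ψ‖ := by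
  rw [stepEvolution_eq_exp_hop]
  exact norm_exp_apply_of_mem_skewAdjoint (hop_mem_skewAdjoint _ _ _) ψ

lemma norm_expandingEvolution_apply (α θ : ℝ) (h : Phase → ℕ → Site d n → Site d n → ℝ)
    (m : ℕ) (ψ : Hilb d n) : ‖expandingEvolution d n α θ h m ψ‖ = ‖ψ‖ := by
  induction m with
  | zero => simp [expandingEvolution]
  | succ m ih => rw [expandingEvolution, mul_apply_eq_comp, norm_stepEvolution_apply, ih]

lemma norm_collapsingEvolution_apply (α θ : ℝ) (h : Phase → ℕ → Site d n → Site d n → ℝ)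
    (m : ℕ) (ψ : Hilb d n) : ‖collapsingEvolution d n α θ h m ψ‖ = ‖ψ‖ := by
  induction m generalizing ψ with
  | zero => simp [collapsingEvolution]
  | succ m ih => rw [collapsingEvolution, mul_apply_eq_comp, ih, norm_stepEvolution_apply]

lemma norm_evolution_apply (α θ : ℝ) (h : Phase → ℕ → Site d n → Site d n → ℝ) (ψ : Hilb d n) :
    ‖evolution d n α θ h ψ‖ = ‖ψ‖ := by
  rw [evolution, mul_apply_eq_comp, norm_collapsingEvolution_apply,
    norm_expandingEvolution_apply]

/-- Errors of the single steps add up at most linearly, since all evolutions are unitary. -/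
lemma norm_evolution_sub_le (α θ : ℝ) (h h' : Phase → ℕ → Site d n → Site d n → ℝ) :
    ‖evolution d n α θ h - evolution d n α θ h'‖ ≤
      (∑ m ∈ Finset.range n, ‖stepEvolution d n α θ h .collapsing (m + 1)
        - stepEvolution d n α θ h' .collapsing (m + 1)‖) +
      ∑ m ∈ Finset.range n, ‖stepEvolution d n α θ h .expanding (m + 1)
        - stepEvolution d n α θ h' .expanding (m + 1)‖ := by
  have h1 : ∀ m, ‖expandingEvolution d n α θ h m - expandingEvolution d n α θ h' m‖ ≤
      ∑ m ∈ Finset.range m, ‖stepEvolution d n α θ h .expanding (m + 1)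
        - stepEvolution d n α θ h' .expanding (m + 1)‖ := by
    intro m
    induction m with
    | zero => simp [expandingEvolution]
    | succ m ih =>
      rw [Finset.sum_range_succ, expandingEvolution, expandingEvolution]
      refine (norm_mul_sub_mul_le (norm_le_one_of_norm_map (norm_stepEvolution_apply α θ h _ _))
        (norm_le_one_of_norm_map (norm_expandingEvolution_apply α θ h' m))).trans ?_
      linarith
  have h2 : ∀ m, ‖collapsingEvolution d n α θ h m - collapsingEvolution d n α θ h' m‖ ≤
      ∑ m ∈ Finset.range m, ‖stepEvolution d n α θ h .collapsing (m + 1)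
        - stepEvolution d n α θ h' .collapsing (m + 1)‖ := by
    intro m
    induction m with
    | zero => simp [collapsingEvolution]
    | succ m ih =>
      rw [Finset.sum_range_succ, collapsingEvolution, collapsingEvolution]
      refine (norm_mul_sub_mul_le
        (norm_le_one_of_norm_map (norm_collapsingEvolution_apply α θ h m))
        (norm_le_one_of_norm_map (norm_stepEvolution_apply α θ h' _ _))).trans ?_
      linarith
  refine (norm_mul_sub_mul_le (norm_le_one_of_norm_map (norm_collapsingEvolution_apply α θ h n))
    (norm_le_one_of_norm_map (norm_expandingEvolution_apply α θ h' n))).trans ?_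
  exact add_le_add (h2 n) (h1 n)

lemma one_lt_two_pow_real (hd : 1 ≤ d) : (1 : ℝ) < 2 ^ d :=
  one_lt_pow₀ one_lt_two (by omega)

lemma sqrt_card_cube (s : Phase) {m : ℕ} (hm : m ≤ n) :
    √((cube d n s m).card : ℝ) = √((2 : ℝ) ^ d) ^ m := by
  rw [cast_card_cube s hm, Real.sqrt_eq_iff_mul_self_eq (by positivity) (by positivity),
    ← mul_pow, Real.mul_self_sqrt (by positivity)]

lemma sqrt_card_shell (s : Phase) {m : ℕ} (hm : m < n) :
    √((shell d n s (m + 1)).card : ℝ) = √((2 : ℝ) ^ d - 1) * √((2 : ℝ) ^ d) ^ m := by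
  rw [cast_card_shell s hm, Real.sqrt_mul' _ (by positivity), ← cast_card_cube s hm.le,
    sqrt_card_cube s hm.le]

lemma stepTime_mul_idealCoupling (α θ : ℝ) (s : Phase) {m : ℕ} (hm : m < n) :
    stepTime d n α θ s (m + 1) * idealCoupling α (m + 1) =
      θ / (√((2 : ℝ) ^ d) ^ m * (√((2 : ℝ) ^ d - 1) * √((2 : ℝ) ^ d) ^ m)) := by
  have hC := (idealCoupling_pos α (m + 1)).ne'
  rw [stepTime, Nat.add_sub_cancel, Real.sqrt_mul (by positivity), sqrt_card_cube s hm.le,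
    sqrt_card_shell s hm, div_mul_eq_mul_div, mul_comm (idealCoupling α (m + 1)),
    mul_div_mul_right _ _ hC]

/-- The error of one step, if the noise matrix has norm at most
`γ (√|B_{q-1}| + √|B_q \ B_{q-1}|)`. -/
lemma norm_stepEvolution_sub_le (hd : 1 ≤ d) {α θ ε γ : ℝ} (hθ : 0 ≤ θ) (hε : 0 ≤ ε) (hγ : 0 ≤ γ)
    (x : Phase → ℕ → Site d n → Site d n → ℝ) (s : Phase) {m : ℕ} (hm : m < n)
    (hx : ∀ u v : Site d n → ℝ,
      ∑ j ∈ cube d n s m, ∑ k ∈ shell d n s (m + 1), u j * v k * x s (m + 1) j k ≤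
        γ * (√((cube d n s m).card : ℝ) + √((shell d n s (m + 1)).card : ℝ)) *
        (√(∑ j ∈ cube d n s m, u j ^ 2) * √(∑ k ∈ shell d n s (m + 1), v k ^ 2))) :
    ‖stepEvolution d n α θ (fun _ q j k => idealCoupling α q * (1 + ε * x s q j k)) s (m + 1)
      - stepEvolution d n α θ (fun _ q _ _ => idealCoupling α q) s (m + 1)‖ ≤
    θ * ε * γ * (1 + (√((2 : ℝ) ^ d - 1))⁻¹) * (√((2 : ℝ) ^ d))⁻¹ ^ m := by
  have hD := one_lt_two_pow_real hd
  have ha : 0 < √((2 : ℝ) ^ d) ^ m := by positivity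
  have hb : 0 < √((2 : ℝ) ^ d - 1) := Real.sqrt_pos.2 (by linarith)
  rw [stepEvolution_eq_exp_hop, stepEvolution_eq_exp_hop]
  refine (norm_exp_sub_exp_le (hop_mem_skewAdjoint _ _ _) (hop_mem_skewAdjoint _ _ _)).trans ?_
  rw [hop_sub, Nat.add_sub_cancel]
  have e : (fun j k => stepTime d n α θ s (m + 1) *
      (phaseSign s * (idealCoupling α (m + 1) * (1 + ε * x s (m + 1) j k))) -
      stepTime d n α θ s (m + 1) * (phaseSign s * idealCoupling α (m + 1)))
      = fun j k => (phaseSign s * ε * (stepTime d n α θ s (m + 1) * idealCoupling α (m + 1)))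
        * x s (m + 1) j k := by
    funext j k; ring
  rw [e, hop_const_mul, norm_smul, Complex.norm_real, stepTime_mul_idealCoupling α θ s hm]
  have hs : ‖phaseSign s‖ = 1 := by cases s <;> simp [phaseSign]
  rw [norm_mul, norm_mul, hs, one_mul, Real.norm_of_nonneg hε,
    Real.norm_of_nonneg (by positivity)]
  have hT := norm_hop_le (disjoint_cube_shell s m) (by positivity) hx
  rw [sqrt_card_cube s hm.le, sqrt_card_shell s hm] at hT
  refine (mul_le_mul_of_nonneg_left hT (by positivity)).trans (le_of_eq ?_)
  rw [inv_pow]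
  field_simp
  ring

/-! ### The ideal protocol -/

/-- The uniform superposition (W state) of the sites in `S`. -/
noncomputable def wState (S : Finset (Site d n)) : Hilb d n :=
  (((√(S.card : ℝ))⁻¹ : ℝ) : ℂ) • ∑ j ∈ S, ket j

lemma sum_ket_apply (S : Finset (Site d n)) (l : Site d n) :
    (∑ j ∈ S, ket j : Hilb d n) l = if l ∈ S then 1 else 0 := by
  simp [ket_apply]

lemma hop_const_apply_left {P Q : Finset (Site d n)} (hPQ : Disjoint P Q) (c : ℝ) :
    hop P Q (fun _ _ => c) (∑ j ∈ P, ket j) = ((c * P.card : ℝ) : ℂ) • ∑ k ∈ Q, ket k := by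
  ext l
  rw [hop_apply, PiLp.smul_apply, sum_ket_apply]
  have h1 : ∑ j ∈ P, (c : ℂ) * (∑ j ∈ P, ket j : Hilb d n) j = c * P.card := by
    rw [Finset.sum_congr rfl fun j hj => by rw [sum_ket_apply, if_pos hj]]
    simp [mul_comm]
  have h2 : ∑ k ∈ Q, (c : ℂ) * (∑ j ∈ P, ket j : Hilb d n) k = 0 :=
    Finset.sum_eq_zero fun k hk => by
      rw [sum_ket_apply, if_neg (Finset.disjoint_right.1 hPQ hk), mul_zero]
  rw [h1, h2]
  simp

lemma hop_const_apply_right {P Q : Finset (Site d n)} (hPQ : Disjoint P Q) (c : ℝ) :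
    hop P Q (fun _ _ => c) (∑ k ∈ Q, ket k) = -((c * Q.card : ℝ) : ℂ) • ∑ j ∈ P, ket j := by
  ext l
  rw [hop_apply, PiLp.smul_apply, sum_ket_apply]
  have h1 : ∑ k ∈ Q, (c : ℂ) * (∑ k ∈ Q, ket k : Hilb d n) k = c * Q.card := by
    rw [Finset.sum_congr rfl fun j hj => by rw [sum_ket_apply, if_pos hj]]
    simp [mul_comm]
  have h2 : ∑ j ∈ P, (c : ℂ) * (∑ k ∈ Q, ket k : Hilb d n) j = 0 :=
    Finset.sum_eq_zero fun k hk => by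
      rw [sum_ket_apply, if_neg (Finset.disjoint_left.1 hPQ hk), mul_zero]
  rw [h1, h2]
  split_ifs <;> simp

/-- Constant couplings rotate in the plane spanned by the W states of `P` and `Q`. -/
lemma exp_hop_const_wState {P Q : Finset (Site d n)} (hPQ : Disjoint P Q) (hP : P.Nonempty)
    (hQ : Q.Nonempty) (c : ℝ) :
    NormedSpace.exp (hop P Q fun _ _ => c) (wState P) =
        (Real.cos (c * (√(P.card : ℝ) * √(Q.card : ℝ))) : ℂ) • wState P +
        (Real.sin (c * (√(P.card : ℝ) * √(Q.card : ℝ))) : ℂ) • wState Q ∧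
    NormedSpace.exp (hop P Q fun _ _ => c) (wState Q) =
        (Real.cos (c * (√(P.card : ℝ) * √(Q.card : ℝ))) : ℂ) • wState Q -
        (Real.sin (c * (√(P.card : ℝ) * √(Q.card : ℝ))) : ℂ) • wState P := by
  have hp : 0 < √(P.card : ℝ) := Real.sqrt_pos.2 (Nat.cast_pos.2 hP.card_pos)
  have hq : 0 < √(Q.card : ℝ) := Real.sqrt_pos.2 (Nat.cast_pos.2 hQ.card_pos)
  have key : ∀ N K : ℝ, 0 < √N → 0 < √K → (√N)⁻¹ * (c * N) = c * (√N * √K) * (√K)⁻¹ := by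
    intro N K hN hK
    have h := Real.mul_self_sqrt (Real.sqrt_pos.1 hN).le
    have h' : (√N)⁻¹ * N = √N := by rw [inv_mul_eq_iff_eq_mul₀ hN.ne', h]
    rw [mul_left_comm, h', mul_assoc, mul_assoc, mul_inv_cancel₀ hK.ne', mul_one]
  set φ := c * (√(P.card : ℝ) * √(Q.card : ℝ)) with hφ
  have h1 : hop P Q (fun _ _ => c) (wState P) = (φ : ℂ) • wState Q := by
    rw [wState, map_smul, hop_const_apply_left hPQ, wState, smul_smul, smul_smul,
      ← Complex.ofReal_mul, ← Complex.ofReal_mul, key _ _ hp hq]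
  have h2 : hop P Q (fun _ _ => c) (wState Q) = -(φ : ℂ) • wState P := by
    rw [wState, map_smul, hop_const_apply_right hPQ, wState, smul_smul, smul_smul, mul_neg,
      neg_mul, ← Complex.ofReal_mul, ← Complex.ofReal_mul, key _ _ hq hp, hφ,
      mul_comm (√(Q.card : ℝ))]
  refine ⟨exp_apply_of_rotation h1 h2, ?_⟩
  have h3 := exp_apply_of_rotation (θ := -φ) (e₁ := wState Q) (e₂ := wState P)
    (by rw [h2, Complex.ofReal_neg]) (by rw [h1, Complex.ofReal_neg, neg_neg])
  rw [h3, Real.cos_neg, Real.sin_neg, Complex.ofReal_neg, neg_smul, sub_eq_add_neg]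

lemma cube_nonempty (s : Phase) {m : ℕ} (hm : m ≤ n) : (cube d n s m).Nonempty := by
  rw [← Finset.card_pos, card_cube s hm]; positivity

lemma shell_nonempty (hd : 1 ≤ d) (s : Phase) {m : ℕ} (hm : m < n) :
    (shell d n s (m + 1)).Nonempty := by
  rw [← Finset.card_pos]
  have h : (0 : ℝ) < (shell d n s (m + 1)).card := by
    rw [cast_card_shell s hm]
    have := one_lt_two_pow_real hd
    have : 0 < (2 : ℝ) ^ d - 1 := by linarith
    positivity
  exact_mod_cast h

/-- At the angle of perfect transfer, the W state of a cube is the rotated W state of the next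
smaller cube. -/
lemma wState_cube_succ (hd : 1 ≤ d) (s : Phase) {m : ℕ} (hm : m < n) :
    wState (cube d n s (m + 1)) =
      (Real.cos (Real.arctan √((2 : ℝ) ^ d - 1)) : ℂ) • wState (cube d n s m) +
      (Real.sin (Real.arctan √((2 : ℝ) ^ d - 1)) : ℂ) • wState (shell d n s (m + 1)) := by
  have hD := one_lt_two_pow_real hd
  have ha : 0 < √((2 : ℝ) ^ d) := by positivity
  have hb : 0 < √((2 : ℝ) ^ d - 1) := Real.sqrt_pos.2 (by linarith)
  have hab : 1 + √((2 : ℝ) ^ d - 1) ^ 2 = 2 ^ d := by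
    rw [Real.sq_sqrt (by linarith)]; ring
  unfold wState
  rw [sqrt_card_cube s (by omega), sqrt_card_cube s hm.le, sqrt_card_shell s hm, Real.cos_arctan,
    Real.sin_arctan, hab, ← cube_union_shell, Finset.sum_union (disjoint_cube_shell s m),
    smul_add, smul_smul, smul_smul, ← Complex.ofReal_mul, ← Complex.ofReal_mul]
  congr 3
  · rw [pow_succ]; field_simp
  · rw [pow_succ]; field_simp

lemma stepEvolution_ideal (α θ : ℝ) (s : Phase) (m : ℕ) :
    stepEvolution d n α θ (fun _ q _ _ => idealCoupling α q) s (m + 1) =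
      NormedSpace.exp (hop (cube d n s m) (shell d n s (m + 1)) fun _ _ =>
        phaseSign s * (stepTime d n α θ s (m + 1) * idealCoupling α (m + 1))) := by
  rw [stepEvolution_eq_exp_hop, Nat.add_sub_cancel]
  congr 2
  funext j k
  ring

lemma rotation_angle (hd : 1 ≤ d) (α θ : ℝ) (s : Phase) {m : ℕ} (hm : m < n) :
    phaseSign s * (stepTime d n α θ s (m + 1) * idealCoupling α (m + 1)) *
      (√((cube d n s m).card : ℝ) * √((shell d n s (m + 1)).card : ℝ)) = phaseSign s * θ := by
  have hD := one_lt_two_pow_real hd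
  have hb : 0 < √((2 : ℝ) ^ d - 1) := Real.sqrt_pos.2 (by linarith)
  rw [stepTime_mul_idealCoupling α θ s hm, sqrt_card_cube s hm.le, sqrt_card_shell s hm]
  field_simp

lemma expandingEvolution_ideal_apply (hd : 1 ≤ d) (α : ℝ) {m : ℕ} (hm : m ≤ n) :
    expandingEvolution d n α (Real.arctan √((2 : ℝ) ^ d - 1))
      (fun _ q _ _ => idealCoupling α q) m (ket (initialSite d n))
      = wState (cube d n .expanding m) := by
  induction m with
  | zero => simp [expandingEvolution, cube_expanding_zero, wState]
  | succ m ih =>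
    rw [expandingEvolution, mul_apply_eq_comp, ih (by omega), stepEvolution_ideal,
      (exp_hop_const_wState (disjoint_cube_shell _ m) (cube_nonempty _ (by omega))
        (shell_nonempty hd _ hm) _).1, rotation_angle hd α _ _ hm, wState_cube_succ hd _ hm]
    simp [phaseSign]

lemma collapsingEvolution_ideal_apply (hd : 1 ≤ d) (α : ℝ) {m : ℕ} (hm : m ≤ n) :
    collapsingEvolution d n α (Real.arctan √((2 : ℝ) ^ d - 1))
      (fun _ q _ _ => idealCoupling α q) m (wState (cube d n .collapsing m))
      = ket (finalSite d n) := by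
  induction m with
  | zero => simp [collapsingEvolution, cube_collapsing_zero, wState]
  | succ m ih =>
    have hrot := exp_hop_const_wState (disjoint_cube_shell .collapsing m)
      (cube_nonempty .collapsing (by omega)) (shell_nonempty hd .collapsing hm)
      (phaseSign .collapsing * (stepTime d n α (Real.arctan √((2 : ℝ) ^ d - 1)) .collapsing (m + 1)
        * idealCoupling α (m + 1)))
    rw [rotation_angle hd α _ _ hm] at hrot
    rw [collapsingEvolution, mul_apply_eq_comp, wState_cube_succ hd _ hm, stepEvolution_ideal,
      map_add, map_smul, map_smul, hrot.1, hrot.2]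
    set φ := Real.arctan √((2 : ℝ) ^ d - 1)
    have hcs : (Real.cos φ : ℂ) * Real.cos φ + Real.sin φ * Real.sin φ = 1 := by
      have := Real.cos_sq_add_sin_sq φ
      rw [sq, sq] at this
      exact_mod_cast this
    have e : (phaseSign .collapsing) * φ = -φ := by simp [phaseSign]
    rw [e, Real.cos_neg, Real.sin_neg, ← ih (by omega)]
    congr 1
    calc _ = ((Real.cos φ : ℂ) * Real.cos φ + Real.sin φ * Real.sin φ) •
          wState (cube d n .collapsing m) := by push_cast; module
      _ = _ := by rw [hcs, one_smul]

/-- Perfect transfer by the ideal protocol. -/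
theorem idealEvolution_apply_ket (hd : 1 ≤ d) (α : ℝ) :
    idealEvolution d n α (Real.arctan √((2 : ℝ) ^ d - 1)) (ket (initialSite d n))
      = ket (finalSite d n) := by
  rw [idealEvolution, evolution, mul_apply_eq_comp, expandingEvolution_ideal_apply hd α le_rfl,
    cube_expanding_self, ← cube_collapsing_self, collapsingEvolution_ideal_apply hd α le_rfl]

/-! ### Fidelity -/

lemma one_sub_norm_inner_sq_le {E : Type*} [NormedAddCommGroup E] [InnerProductSpace ℂ E]
    {a b : E} (ha : ‖a‖ = 1) (hb : ‖b‖ = 1) : 1 - ‖⟪a, b⟫_ℂ‖ ^ 2 ≤ ‖b - a‖ ^ 2 := by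
  have h1 : ‖⟪a, b⟫_ℂ‖ ≤ 1 := by simpa [ha, hb] using norm_inner_le_norm (𝕜 := ℂ) a b
  have h2 := norm_sub_sq (𝕜 := ℂ) a b
  have h3 : RCLike.re ⟪a, b⟫_ℂ ≤ ‖⟪a, b⟫_ℂ‖ := RCLike.re_le_norm _
  rw [ha, hb, norm_sub_rev] at h2
  have h4 := norm_nonneg ⟪a, b⟫_ℂ
  nlinarith

lemma fidelity_loss_le (α θ ε : ℝ) (x : Phase → ℕ → Site d n → Site d n → ℝ) {ψ : Hilb d n}
    (hψ : ‖ψ‖ = 1) :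
    1 - ‖⟪idealEvolution d n α θ ψ, noisyEvolution d n α θ ε x ψ⟫_ℂ‖ ^ 2
      ≤ deltaRand d n α θ ε x ^ 2 := by
  refine (one_sub_norm_inner_sq_le ((norm_evolution_apply _ _ _ ψ).trans hψ)
    ((norm_evolution_apply _ _ _ ψ).trans hψ)).trans ?_
  have h := (noisyEvolution d n α θ ε x - idealEvolution d n α θ).le_opNorm ψ
  rw [hψ, mul_one] at h
  exact pow_le_pow_left₀ (norm_nonneg _) h 2

end Protocol

/-! ### The failure probability -/

section FailureProbability

open MeasureTheory ProbabilityTheory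

lemma eq_zero_of_sqrt_sum_sq_eq_zero {κ : Type*} [Fintype κ] {w : κ → ℝ}
    (hw : √(∑ j, w j ^ 2) = 0) : w = 0 := by
  rw [Real.sqrt_eq_zero (by positivity),
    Finset.sum_eq_zero_iff_of_nonneg fun _ _ => by positivity] at hw
  funext j
  simpa using hw j (Finset.mem_univ j)

lemma sum_div_sqrt_sq_eq_one {κ : Type*} [Fintype κ] {w : κ → ℝ} (hw : 0 < √(∑ j, w j ^ 2)) :
    ∑ j, (w j / √(∑ j, w j ^ 2)) ^ 2 = 1 := by
  simp only [div_pow]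
  rw [← Finset.sum_div, Real.sq_sqrt (by positivity), div_self (Real.sqrt_pos.1 hw).ne']

lemma bilin_le_mul_of_unit {m n : Type*} [Fintype m] [Fintype n] {X : m × n → ℝ} {T : ℝ}
    (h : ∀ u v, ∑ j, u j ^ 2 = 1 → ∑ k, v k ^ 2 = 1 → bilin X u v ≤ T) (u : m → ℝ) (v : n → ℝ) :
    bilin X u v ≤ T * (√(∑ j, u j ^ 2) * √(∑ k, v k ^ 2)) := by
  rcases (Real.sqrt_nonneg (∑ j, u j ^ 2)).eq_or_lt with hu | hu
  · simp [eq_zero_of_sqrt_sum_sq_eq_zero hu.symm, bilin]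
  rcases (Real.sqrt_nonneg (∑ k, v k ^ 2)).eq_or_lt with hv | hv
  · simp [eq_zero_of_sqrt_sum_sq_eq_zero hv.symm, bilin]
  have h1 := h _ _ (sum_div_sqrt_sq_eq_one hu) (sum_div_sqrt_sq_eq_one hv)
  set a := √(∑ j, u j ^ 2)
  set b := √(∑ k, v k ^ 2)
  have e : bilin X u v = bilin X (fun j => u j / a) (fun k => v k / b) * (a * b) := by
    unfold bilin
    rw [Finset.sum_mul]
    refine Finset.sum_congr rfl fun p _ => ?_
    field_simp
  rw [e]
  exact mul_le_mul_of_nonneg_right h1 (by positivity)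

lemma rateA_pos (d : ℕ) {γ : ℝ} (hγ : 1 < γ) : 0 < rateA d γ := by
  have : 0 < γ - 1 := by linarith
  unfold rateA
  positivity

lemma rateA_mul_two_pow {d : ℕ} (hd : 1 ≤ d) (γ : ℝ) (m : ℕ) :
    ((γ - 1) * (√((2 : ℝ) ^ d) ^ m + √((2 : ℝ) ^ d - 1) * √((2 : ℝ) ^ d) ^ m)) ^ 2 / 2
      = rateA d γ * ((2 : ℝ) ^ d) ^ (m + 1) := by
  have hD := one_lt_two_pow_real hd
  have hb : √((2 : ℝ) ^ d - 1) ^ 2 = 2 ^ d - 1 := Real.sq_sqrt (by linarith)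
  have ha : (√((2 : ℝ) ^ d) ^ m) ^ 2 = ((2 : ℝ) ^ d) ^ m := by
    rw [← pow_mul, mul_comm, pow_mul, Real.sq_sqrt (by positivity)]
  have h2 : (2 : ℝ) ^ (1 - (d : ℝ)) * 2 ^ d = 2 := by
    rw [← Real.rpow_natCast 2 d, ← Real.rpow_add two_pos]; simp
  calc _ = (γ - 1) ^ 2 * (√((2 : ℝ) ^ d) ^ m) ^ 2 *
        (1 + 2 * √((2 : ℝ) ^ d - 1) + √((2 : ℝ) ^ d - 1) ^ 2) / 2 := by ring
    _ = (γ - 1) ^ 2 * ((2 : ℝ) ^ d) ^ m * (2 ^ d + ((2 : ℝ) ^ (1 - (d : ℝ)) * 2 ^ d)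
        * √((2 : ℝ) ^ d - 1)) / 2 := by rw [ha, hb, h2]; ring
    _ = _ := by rw [rateA, pow_succ]; ring

/-- The Gaussian tail is far below the geometric term that the failure bound provides for it,
because `k + 1 ≤ 2 ^ k` and `log 2 ≤ 1`. -/
lemma exp_neg_rateA_le (d : ℕ) {γ : ℝ} (hγ : 1 < γ) (m : ℕ) :
    Real.exp (-(rateA d γ * ((2 : ℝ) ^ d) ^ (m + 1))) ≤
      (2 : ℝ) ^ (-(rateA d γ * ((d : ℝ) + 1))) * ((2 : ℝ) ^ (-(rateA d γ * (d : ℝ)))) ^ m := by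
  have hA := rateA_pos d hγ
  rw [← Real.rpow_natCast _ m, ← Real.rpow_mul two_pos.le, ← Real.rpow_add two_pos,
    Real.rpow_def_of_pos two_pos]
  refine Real.exp_le_exp.2 ?_
  have hk : ((d * (m + 1) : ℕ) : ℝ) + 1 ≤ ((2 : ℝ) ^ d) ^ (m + 1) := by
    rw [← pow_mul]
    exact_mod_cast Nat.lt_two_pow_self (n := d * (m + 1))
  push_cast at hk
  have hlog : Real.log 2 ≤ 1 := Real.log_two_lt_d9.le.trans (by norm_num)
  have h0 : 0 ≤ (d : ℝ) * (m + 1) + 1 := by positivity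
  have h1 : Real.log 2 * ((d : ℝ) * (m + 1) + 1) ≤ ((2 : ℝ) ^ d) ^ (m + 1) :=
    (mul_le_of_le_one_left h0 hlog).trans hk
  have h2 := mul_le_mul_of_nonneg_left h1 hA.le
  linarith

variable {d n : ℕ} {Ω : Type*} [MeasurableSpace Ω] {μ : Measure Ω} [IsProbabilityMeasure μ]
  {X : Phase → ℕ → Site d n → Site d n → Ω → ℝ}

lemma IsGaussianNoise.map_eq (hX : IsGaussianNoise μ d n X) (s : Phase) {m : ℕ} (hm : m < n) :
    AEMeasurable (fun ω (p : ↥(cube d n s m) × ↥(shell d n s (m + 1))) =>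
      X s (m + 1) p.1 p.2 ω) μ ∧
    μ.map (fun ω (p : ↥(cube d n s m) × ↥(shell d n s (m + 1))) => X s (m + 1) p.1 p.2 ω)
      = stdGauss (↥(cube d n s m) × ↥(shell d n s (m + 1))) := by
  have hmem : ∀ p : ↥(cube d n s m) × ↥(shell d n s (m + 1)),
      ((p.1 : Site d n), (p.2 : Site d n)) ∈ coupledPairs d n s (m + 1) := fun p =>
    Finset.mem_product.2 ⟨p.1.2, p.2.2⟩
  have hlaw : ∀ p : ↥(cube d n s m) × ↥(shell d n s (m + 1)),
      HasLaw (X s (m + 1) p.1 p.2) (gaussianReal 0 1) μ := fun p =>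
    hX.hasLaw s (m + 1) (by omega) (by omega) _ (hmem p)
  have hind : iIndepFun (fun p : ↥(cube d n s m) × ↥(shell d n s (m + 1)) =>
      X s (m + 1) p.1 p.2) μ := by
    refine (hX.indep s (m + 1) (by omega) (by omega)).precomp
      (g := fun p : ↥(cube d n s m) × ↥(shell d n s (m + 1)) =>
        (⟨((p.1 : Site d n), (p.2 : Site d n)), hmem p⟩ :
          {p : Site d n × Site d n // p ∈ coupledPairs d n s (m + 1)})) ?_
    intro p p' h
    simp only [Subtype.mk.injEq, Prod.mk.injEq] at h
    exact Prod.ext (Subtype.ext h.1) (Subtype.ext h.2)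
  refine ⟨aemeasurable_pi_lambda _ fun p => (hlaw p).aemeasurable, ?_⟩
  rw [(iIndepFun_iff_map_fun_eq_pi_map fun p => (hlaw p).aemeasurable).1 hind]
  congr 1
  funext p
  exact (hlaw p).map_eq

/-- The noise matrix of step `m + 1` has norm at most `γ (√|B_m| + √|B_{m+1} \ B_m|)`. -/
def StepBound (γ : ℝ) (s : Phase) (m : ℕ) (x : Phase → ℕ → Site d n → Site d n → ℝ) : Prop :=
  ∀ u v : Site d n → ℝ,
    ∑ j ∈ cube d n s m, ∑ k ∈ shell d n s (m + 1), u j * v k * x s (m + 1) j k ≤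
      γ * (√((cube d n s m).card : ℝ) + √((shell d n s (m + 1)).card : ℝ)) *
      (√(∑ j ∈ cube d n s m, u j ^ 2) * √(∑ k ∈ shell d n s (m + 1), v k ^ 2))

lemma measure_not_stepBound_le (hd : 1 ≤ d) {γ : ℝ} (hγ : 1 < γ) (hX : IsGaussianNoise μ d n X)
    (s : Phase) {m : ℕ} (hm : m < n) :
    μ {ω | ¬ StepBound γ s m fun s q j k => X s q j k ω} ≤
      ENNReal.ofReal (Real.exp (-(rateA d γ * ((2 : ℝ) ^ d) ^ (m + 1)))) := by
  obtain ⟨hmeas, hmap⟩ := hX.map_eq s hm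
  set t := (γ - 1) * (√((cube d n s m).card : ℝ) + √((shell d n s (m + 1)).card : ℝ)) with ht
  have ht0 : 0 ≤ t := mul_nonneg (by linarith) (by positivity)
  have hexp : t ^ 2 / 2 = rateA d γ * ((2 : ℝ) ^ d) ^ (m + 1) := by
    rw [ht, sqrt_card_cube s hm.le, sqrt_card_shell s hm, rateA_mul_two_pow hd]
  rw [← hexp]
  refine le_trans (measure_mono ?_) ((Measure.le_map_apply hmeas _).trans
    (hmap ▸ stdGauss_not_bilin_le ↥(cube d n s m) ↥(shell d n s (m + 1)) ht0))
  intro ω hω hgood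
  refine hω fun u v => ?_
  have h := bilin_le_mul_of_unit hgood (fun j => u j) (fun k => v k)
  rw [Fintype.card_coe, Fintype.card_coe, bilin, Fintype.sum_prod_type,
    Finset.sum_coe_sort (cube d n s m) fun j => u j ^ 2,
    Finset.sum_coe_sort (shell d n s (m + 1)) fun k => v k ^ 2,
    Finset.sum_coe_sort (cube d n s m) fun j => ∑ k : ↥(shell d n s (m + 1)),
      u j * v k * X s (m + 1) j k ω] at h
  have e : √((cube d n s m).card : ℝ) + √((shell d n s (m + 1)).card : ℝ) + t
      = γ * (√((cube d n s m).card : ℝ) + √((shell d n s (m + 1)).card : ℝ)) := by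
    rw [ht]; ring
  rw [e] at h
  refine le_trans (le_of_eq (Finset.sum_congr rfl fun j _ => ?_)) h
  exact (Finset.sum_coe_sort (shell d n s (m + 1)) fun k => u j * v k * X s (m + 1) j k ω).symm

/-- If the noise matrices of all steps are bounded, the error bound holds. -/
lemma deltaRand_le_errorBound (hd : 1 ≤ d) {α θ ε γ : ℝ} (hθ : 0 ≤ θ)
    (hθ' : θ ≤ Real.arctan ((2 : ℝ) ^ d - 1)) (hε : 0 ≤ ε) (hγ : 1 < γ)
    {x : Phase → ℕ → Site d n → Site d n → ℝ} (hx : ∀ s, ∀ m < n, StepBound γ s m x) :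
    deltaRand d n α θ ε x ≤ errorBound d ε γ ((2 : ℝ) ^ n) := by
  have hD := one_lt_two_pow_real hd
  set b := √((2 : ℝ) ^ d - 1) with hb
  set q := (√((2 : ℝ) ^ d))⁻¹ with hq
  have hq0 : 0 < q := by positivity
  have hq1 : q < 1 := inv_lt_one_of_one_lt₀ (Real.lt_sqrt_of_sq_lt (by simpa using hD))
  have hqr : (2 : ℝ) ^ (-((d : ℝ) / 2)) = q := by
    rw [hq, Real.sqrt_eq_rpow, ← Real.rpow_natCast 2 d, ← Real.rpow_mul two_pos.le,
      ← Real.rpow_neg two_pos.le]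
    congr 1; ring
  have hRr : ((2 : ℝ) ^ n) ^ (-((d : ℝ) / 2)) = q ^ n := by
    rw [← hqr, ← Real.rpow_natCast, ← Real.rpow_natCast, ← Real.rpow_mul two_pos.le,
      ← Real.rpow_mul two_pos.le, mul_comm]
  have hbr : ((2 : ℝ) ^ d - 1) ^ (-(1 / 2) : ℝ) = b⁻¹ := by
    rw [hb, Real.sqrt_eq_rpow, Real.rpow_neg (by linarith)]
  have hstep : ∀ s, ∀ m ∈ Finset.range n,
      ‖stepEvolution d n α θ (fun s q j k => idealCoupling α q * (1 + ε * x s q j k)) s (m + 1)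
        - stepEvolution d n α θ (fun _ q _ _ => idealCoupling α q) s (m + 1)‖ ≤
      θ * ε * γ * (1 + b⁻¹) * q ^ m := fun s m hm =>
    norm_stepEvolution_sub_le hd hθ hε (by linarith) x s (Finset.mem_range.1 hm)
      (hx s m (Finset.mem_range.1 hm))
  have hgeom : ∑ m ∈ Finset.range n, θ * ε * γ * (1 + b⁻¹) * q ^ m
      = θ * ε * γ * (1 + b⁻¹) * ((1 - q ^ n) / (1 - q)) := by
    rw [← Finset.mul_sum, geom_sum_eq hq1.ne, ← neg_div_neg_eq, neg_sub, neg_sub]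
  have h := (norm_evolution_sub_le α θ (fun s q j k => idealCoupling α q * (1 + ε * x s q j k))
    (fun _ q _ _ => idealCoupling α q)).trans (add_le_add
      (Finset.sum_le_sum (hstep .collapsing)) (Finset.sum_le_sum (hstep .expanding)))
  rw [hgeom] at h
  refine h.trans ?_
  unfold errorBound
  rw [hRr, hqr, hbr]
  have hfac : 0 ≤ ε * γ * (1 + b⁻¹) * ((1 - q ^ n) / (1 - q)) := by
    have h1 : 0 ≤ 1 - q ^ n := sub_nonneg.2 (pow_le_one₀ hq0.le hq1.le)
    have h2 : 0 ≤ 1 - q := by linarith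
    have h3 : 0 ≤ γ := by linarith
    positivity
  have := mul_le_mul_of_nonneg_right hθ' hfac
  linarith

lemma measure_deltaRand_gt_lt (hd : 1 ≤ d) (hn : 1 ≤ n) {α θ ε γ : ℝ} (hθ : 0 ≤ θ)
    (hθ' : θ ≤ Real.arctan ((2 : ℝ) ^ d - 1)) (hε : 0 ≤ ε) (hγ : 1 < γ)
    (hX : IsGaussianNoise μ d n X) :
    μ.real {ω | ¬ deltaRand d n α θ ε (fun s q j k => X s q j k ω)
      ≤ errorBound d ε γ ((2 : ℝ) ^ n)} < failBound d γ ((2 : ℝ) ^ n) := by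
  have hA := rateA_pos d hγ
  set ρ := (2 : ℝ) ^ (-(rateA d γ * (d : ℝ))) with hρ
  set K := (2 : ℝ) ^ (-(rateA d γ * ((d : ℝ) + 1))) with hK
  have hK0 : 0 < K := Real.rpow_pos_of_pos two_pos _
  have hρ0 : 0 < ρ := Real.rpow_pos_of_pos two_pos _
  have hρ1 : ρ < 1 := by
    refine Real.rpow_lt_one_of_one_lt_of_neg one_lt_two ?_
    have : 0 < (d : ℝ) := by exact_mod_cast hd
    have := mul_pos hA this
    linarith
  have hsub : {ω | ¬ deltaRand d n α θ ε (fun s q j k => X s q j k ω)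
      ≤ errorBound d ε γ ((2 : ℝ) ^ n)} ⊆ ⋃ m ∈ Finset.range n,
        ({ω | ¬ StepBound γ .expanding m fun s q j k => X s q j k ω} ∪
          {ω | ¬ StepBound γ .collapsing m fun s q j k => X s q j k ω}) := by
    intro ω hω
    by_contra hcon
    simp only [Set.mem_iUnion, not_exists, Set.mem_union, not_or, Finset.mem_range,
      Set.mem_ofPred_eq, not_not] at hcon
    refine hω (deltaRand_le_errorBound hd hθ hθ' hε hγ fun s m hm => ?_)
    cases s
    · exact (hcon m hm).1
    · exact (hcon m hm).2
  have hterm : ∀ s, ∀ m ∈ Finset.range n, μ {ω | ¬ StepBound γ s m fun s q j k => X s q j k ω} ≤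
      ENNReal.ofReal (K * ρ ^ m) := fun s m hm =>
    (measure_not_stepBound_le hd hγ hX s (Finset.mem_range.1 hm)).trans
      (ENNReal.ofReal_le_ofReal (exp_neg_rateA_le d hγ m))
  have hle : μ {ω | ¬ deltaRand d n α θ ε (fun s q j k => X s q j k ω)
      ≤ errorBound d ε γ ((2 : ℝ) ^ n)} ≤
      ENNReal.ofReal (∑ m ∈ Finset.range n, (K * ρ ^ m + K * ρ ^ m)) := by
    refine (measure_mono hsub).trans ((measure_biUnion_finset_le _ _).trans ?_)
    rw [ENNReal.ofReal_sum_of_nonneg fun m _ => by positivity]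
    refine Finset.sum_le_sum fun m hm => (measure_union_le _ _).trans ?_
    rw [ENNReal.ofReal_add (by positivity) (by positivity)]
    exact add_le_add (hterm _ m hm) (hterm _ m hm)
  have hreal := ENNReal.toReal_mono ENNReal.ofReal_ne_top hle
  rw [ENNReal.toReal_ofReal (Finset.sum_nonneg fun m _ => by positivity)] at hreal
  refine lt_of_le_of_lt hreal ?_
  have hsum : ∑ m ∈ Finset.range n, (K * ρ ^ m + K * ρ ^ m)
      = 2 * (K * ((1 - ρ ^ n) / (1 - ρ))) := by
    rw [Finset.sum_add_distrib, ← Finset.mul_sum, geom_sum_eq hρ1.ne, ← neg_div_neg_eq, neg_sub,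
      neg_sub]
    ring
  have hRr : ((2 : ℝ) ^ n) ^ (-(rateA d γ * (d : ℝ))) = ρ ^ n := by
    rw [hρ, ← Real.rpow_natCast, ← Real.rpow_natCast, ← Real.rpow_mul two_pos.le,
      ← Real.rpow_mul two_pos.le, mul_comm]
  have hK4 : (2 : ℝ) ^ (-(rateA d γ * ((d : ℝ) + 1)) + 2) = K * 4 := by
    rw [Real.rpow_add two_pos, ← hK]; norm_num
  rw [hsum, failBound, hRr, hK4]
  have hpos : 0 < K * ((1 - ρ ^ n) / (1 - ρ)) :=
    mul_pos hK0 (div_pos (sub_pos.2 (pow_lt_one₀ hρ0.le hρ1 (by omega))) (by linarith))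
  linarith

/-! ### The limit of large distance -/

lemma two_rpow_neg_lt_one {x : ℝ} (hx : 0 < x) : (2 : ℝ) ^ (-x) < 1 :=
  Real.rpow_lt_one_of_one_lt_of_neg one_lt_two (by linarith)

lemma errorBound_le_errorLimit {d : ℕ} (hd : 1 ≤ d) {ε γ R : ℝ} (hε : 0 ≤ ε) (hγ : 0 ≤ γ)
    (hR : 0 < R) : errorBound d ε γ R ≤ errorLimit d ε γ := by
  have hD := one_lt_two_pow_real hd
  have hd0 : 0 < (d : ℝ) := by exact_mod_cast hd
  have h1 := two_rpow_neg_lt_one (half_pos hd0)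
  have h2 : 0 ≤ R ^ (-((d : ℝ) / 2)) := Real.rpow_nonneg hR.le _
  have h3 : 0 ≤ Real.arctan ((2 : ℝ) ^ d - 1) := Real.arctan_nonneg.2 (by linarith)
  have h4 : 0 ≤ ((2 : ℝ) ^ d - 1) ^ (-(1 / 2) : ℝ) := Real.rpow_nonneg (by linarith) _
  rw [errorBound, errorLimit, ← mul_div_assoc]
  refine div_le_div_of_nonneg_right (mul_le_of_le_one_right (by positivity) ?_) ?_ <;> linarith

lemma failBound_le_failLimit {d : ℕ} (hd : 1 ≤ d) {γ R : ℝ} (hγ : 1 < γ) (hR : 0 < R) :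
    failBound d γ R ≤ failLimit d γ := by
  have hd0 : 0 < (d : ℝ) := by exact_mod_cast hd
  have h1 := two_rpow_neg_lt_one (mul_pos (rateA_pos d hγ) hd0)
  have h2 : 0 ≤ R ^ (-(rateA d γ * (d : ℝ))) := Real.rpow_nonneg hR.le _
  rw [failBound, failLimit, ← mul_div_assoc]
  refine div_le_div_of_nonneg_right (mul_le_of_le_one_right (by positivity) ?_) ?_ <;> linarith

lemma tendsto_errorBound {d : ℕ} (hd : 1 ≤ d) (ε γ : ℝ) :
    Filter.Tendsto (fun R : ℝ => errorBound d ε γ R) Filter.atTop (nhds (errorLimit d ε γ)) := by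
  have hd0 : 0 < (d : ℝ) := by exact_mod_cast hd
  have h := ((((tendsto_rpow_neg_atTop (half_pos hd0)).const_sub 1).div_const
    (1 - (2 : ℝ) ^ (-((d : ℝ) / 2)))).const_mul (2 * ε * γ * Real.arctan ((2 : ℝ) ^ d - 1) *
      (1 + ((2 : ℝ) ^ d - 1) ^ (-(1 / 2) : ℝ))))
  rwa [sub_zero, mul_one_div] at h

lemma tendsto_failBound {d : ℕ} (hd : 1 ≤ d) {γ : ℝ} (hγ : 1 < γ) :
    Filter.Tendsto (fun R : ℝ => failBound d γ R) Filter.atTop (nhds (failLimit d γ)) := by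
  have hd0 : 0 < (d : ℝ) := by exact_mod_cast hd
  have h := ((((tendsto_rpow_neg_atTop (mul_pos (rateA_pos d hγ) hd0)).const_sub 1).div_const
    (1 - (2 : ℝ) ^ (-(rateA d γ * (d : ℝ))))).const_mul
      ((2 : ℝ) ^ (-(rateA d γ * ((d : ℝ) + 1)) + 2)))
  rwa [sub_zero, mul_one_div] at h

end FailureProbability

end WState

theorem mainTheorem1 (d : ℕ) (hd : 1 ≤ d) (α ε γ : ℝ) (hε : 0 ≤ ε) (hγ : 1 < γ) :
    (∀ (n : ℕ), 1 ≤ n →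
      ∀ (θ : ℝ), 0 ≤ θ → θ ≤ Real.arctan ((2 : ℝ) ^ d - 1) →
      ∀ (Ω : Type*) [MeasurableSpace Ω] (μ : MeasureTheory.Measure Ω)
        [MeasureTheory.IsProbabilityMeasure μ]
        (X : WState.Phase → ℕ → WState.Site d n → WState.Site d n → Ω → ℝ),
      WState.IsGaussianNoise μ d n X →
        -- the error bound holds except with the claimed failure probability
        μ.real {ω | ¬ WState.deltaRand d n α θ ε (fun s q j k => X s q j k ω)
            ≤ WState.errorBound d ε γ ((2 : ℝ) ^ n)} < WState.failBound d γ ((2 : ℝ) ^ n) ∧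
        -- the fidelity loss relative to the ideal output is at most the squared error
        (∀ (ω : Ω) (ψ : WState.Hilb d n), ‖ψ‖ = 1 →
          1 - ‖⟪WState.idealEvolution d n α θ ψ,
              WState.noisyEvolution d n α θ ε (fun s q j k => X s q j k ω) ψ⟫_ℂ‖ ^ 2
            ≤ WState.deltaRand d n α θ ε (fun s q j k => X s q j k ω) ^ 2) ∧
        -- for the angle of perfect transfer, so is the loss of final-site probability
        (θ = Real.arctan (√((2 : ℝ) ^ d - 1)) →
          WState.idealEvolution d n α θ (WState.ket (WState.initialSite d n))
            = WState.ket (WState.finalSite d n) ∧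
          ∀ ω : Ω,
            1 - ‖(WState.noisyEvolution d n α θ ε (fun s q j k => X s q j k ω)
                (WState.ket (WState.initialSite d n))) (WState.finalSite d n)‖ ^ 2
              ≤ WState.deltaRand d n α θ ε (fun s q j k => X s q j k ω) ^ 2)) ∧
    -- both bounds stay finite as the distance grows
    (∀ R : ℝ, 0 < R → WState.errorBound d ε γ R ≤ WState.errorLimit d ε γ ∧
      WState.failBound d γ R ≤ WState.failLimit d γ) ∧
    Filter.Tendsto (fun R : ℝ => WState.errorBound d ε γ R) Filter.atTop
      (nhds (WState.errorLimit d ε γ)) ∧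
    Filter.Tendsto (fun R : ℝ => WState.failBound d γ R) Filter.atTop
      (nhds (WState.failLimit d γ)) := by
  refine ⟨fun n hn θ hθ hθ' Ω _ μ _ X hX => ⟨?_, ?_, ?_⟩, fun R hR => ⟨?_, ?_⟩, ?_, ?_⟩
  · exact WState.measure_deltaRand_gt_lt hd hn hθ hθ' hε hγ hX
  · exact fun ω ψ hψ => WState.fidelity_loss_le α θ ε _ hψ
  · rintro rfl
    have htransfer := WState.idealEvolution_apply_ket (n := n) hd α
    refine ⟨htransfer, fun ω => ?_⟩
    have h := WState.fidelity_loss_le α (Real.arctan √((2 : ℝ) ^ d - 1)) ε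
      (fun s q j k => X s q j k ω) (ψ := WState.ket (WState.initialSite d n)) (by simp [WState.ket])
    rw [htransfer] at h
    simpa [WState.ket, EuclideanSpace.inner_single_left] using h
  · exact WState.errorBound_le_errorLimit hd hε (by linarith) hR
  · exact WState.failBound_le_failLimit hd hγ hR
  · exact WState.tendsto_errorBound hd ε γ
  · exact WState.tendsto_failBound hd hγ
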